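/- **Setting.** Let $A=\varinjlim A_n$ be a (nonzero) unital inductive limit $C^*$-algebra of a sequence $\mathbb{C}1=A_0\subseteq A_1\subseteq A_2\subseteq\cdots$ of atomic $W^*$-algebras with separable predual (i.e. each $A_n$ is $*$-isomorphic to an $\ell^\infty$-direct sum of algebras $B(\mathcal H)$ over a countable family of nonzero separable Hilbert spaces $\mathcal H$), where all inclusions are unital and normal and $\bigcup_n A_n$ is norm-dense in $A$. Let $\mathfrak{Z}_n$ be the set of minimal projections of the center of $A_n$ (so $\mathfrak{Z}_0=\{1\}$) and let $\mathfrak{Z}=\bigsqcup_{n\ge0}\mathfrak{Z}_n$ be their disjoint union. Let $\alpha^t$, $t\in\mathbb{R}$, be an action of $\mathbb{R}$ on $A$ by $*$-automorphisms such that $\alpha^t(A_n)=A_n$ for all $t,n$, and such that $\|\omega\circ\alpha^t|_{A_n}-\omega\|\to0$ as $t\to0$ for every $n$ and every normal linear functional $\omega$ on $A_n$; then $\alpha^t$ fixes every $z\in\mathfrak{Z}$ and restricts to a flow $\alpha_z^t$ on $zA_n$ for $z\in\mathfrak{Z}_n$. Let $\beta\in\mathbb{R}$. A state $\varphi$ on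 a $C^*$-algebra satisfies the KMS condition for a flow $\gamma^t$ at $\beta$ if for all $a,b$ there is a bounded continuous function $F$ on the strip $\min(0,\beta)\le\operatorname{Im}w\le\max(0,\beta)$, holomorphic in its interior, with $F(t)=\varphi(b\,\gamma^t(a))$ and $F(t+i\beta)=\varphi(\gamma^t(a)\,b)$ for all $t\in\mathbb{R}$. Let $K_\beta^{\mathrm{ln}}(\alpha^t)$ be the set of states on $A$ that satisfy the KMS condition for $\alpha^t$ at $\beta$ and are locally normal, i.e. normal on each $A_n$; it carries the weak$^*$ topology. For $z\in\mathfrak{Z}_n$ there is at most one normal state $\tau_z$ on $zA_n$ satisfying the KMS condition for $\alpha_z^t$ at $\beta$ (the local Gibbs state). For $z\in\mathfrak{Z}_n$ and $z'\in\mathfrak{Z}_m$ with $n>m$, put $\kappa_{(\alpha^t,\beta)}(z,z')=\tau_z(zz')$ if $\tau_z$ exists and $\kappa_{(\alpha^t,\beta)}(z,z')=0$ otherwise. Let $H_1^+(\kappa_{(\alpha^t,\beta)})$ be the set of functions $\nu:\mathfrak{Z}\to\mathbb{C}$ with $\nu\ge0$, with $\nu(1)=1$ at the single vertex $1\in\mathfrak{Z}_0$,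 and with $$\nu(z')=\sum_{z\in\mathfrak{Z}_{n+1}}\nu(z)\,\kappa_{(\alpha^t,\beta)}(z,z')\qquad(n\ge0,\ z'\in\mathfrak{Z}_n)$$ (convergent sums); it carries the topology of pointwise convergence. **Proposition 7.10.** The sets $K_\beta^{\mathrm{ln}}(\alpha^t)$ and $H_1^+(\kappa_{(\alpha^t,\beta)})$ are convex. For $\omega\in K_\beta^{\mathrm{ln}}(\alpha^t)$ the function $\nu[\omega](z):=\omega(z)$, $z\in\mathfrak{Z}$, is bounded, and $\omega\mapsto\nu[\omega]$ is a bijective affine homeomorphism from $K_\beta^{\mathrm{ln}}(\alpha^t)$ onto $H_1^+(\kappa_{(\alpha^t,\beta)})$. -/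

import Mathlib

open scoped ComplexOrder ENNReal Topology

noncomputable section

namespace InductiveKMS

/-! ### Normality, states and the KMS condition -/

/-- A map between ordered spaces is *normal* if it preserves the least upper bound of every
increasing net of positive elements that has one. For positive functionals and for
`*`-homomorphisms of W*-algebras this is the usual definition of normality. Functionals are covered
through the order of `ℂ` in which `w₁ ≤ w₂` means that `w₂ - w₁` is a nonnegative real. -/
def IsNormalMap {M N : Type*} [Preorder M] [Zero M] [Preorder N] (f : M → N) : Prop :=
  ∀ (d : Set M) (x : M), (∀ y ∈ d, 0 ≤ y) → d.Nonempty → DirectedOn (· ≤ ·) d →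
    IsLUB d x → IsLUB (f '' d) (f x)

/-- A linear functional on a `*`-algebra is positive if `φ (x* x) ≥ 0` for all `x`. -/
def IsPositiveFunctional {M : Type*} [Mul M] [Star M] (φ : M → ℂ) : Prop :=
  ∀ x : M, 0 ≤ φ (star x * x)

/-- `φ` is a state of a C*-algebra whose unit is `e`: a positive functional with `φ e = 1`.
The unit is an explicit argument, so that corners `z B`, whose unit is `z`, are covered. -/
def IsStateWithUnit {M : Type*} [Mul M] [Star M] (e : M) (φ : M → ℂ) : Prop :=
  IsPositiveFunctional φ ∧ φ e = 1

/-- The predual of a W*-algebra, as a space of functionals: the normal functionals are the linear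
combinations of the normal positive ones. -/
def predual (M : Type*) [NonUnitalNormedRing M] [NormedSpace ℂ M] [Star M] [Preorder M] :
    Submodule ℂ (M →L[ℂ] ℂ) :=
  Submodule.span ℂ {φ | IsPositiveFunctional φ ∧ IsNormalMap φ}

/-- The closed strip between the lines `Im w = 0` and `Im w = β` (a line if `β = 0`). -/
def closedStrip (β : ℝ) : Set ℂ := {w | min 0 β ≤ w.im ∧ w.im ≤ max 0 β}

/-- The interior of the strip (empty if `β = 0`). -/
def openStrip (β : ℝ) : Set ℂ := {w | min 0 β < w.im ∧ w.im < max 0 β}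

/-- The `(γ, β)`-KMS condition for a functional `φ` and a flow `γ`, in terms of boundary values:
for all `a, b` there is a bounded continuous function on the closed strip, holomorphic inside,
with `F(t) = φ (b γ_t(a))` and `F(t + iβ) = φ (γ_t(a) b)`. No continuity of `γ` is assumed. -/
def IsKMS {M : Type*} [Mul M] (γ : ℝ → M → M) (β : ℝ) (φ : M → ℂ) : Prop :=
  ∀ a b : M, ∃ F : ℂ → ℂ,
    ContinuousOn F (closedStrip β) ∧
    (∃ C : ℝ, ∀ w ∈ closedStrip β, ‖F w‖ ≤ C) ∧
    DifferentiableOn ℂ F (openStrip β) ∧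
    ∀ t : ℝ, F t = φ (b * γ t a) ∧ F (t + Complex.I * β) = φ (γ t a * b)

/-! ### Atomic W*-algebras with separable predual and their minimal central projections -/

/-- `M` is an atomic W*-algebra with separable predual: it is `*`-isomorphic to the `ℓ^∞`-direct sum
of the algebras `B(H i)`, for a countable family of nonzero separable Hilbert spaces `H i`.
(Countable sets and separable Hilbert spaces all have copies in `Type`.) -/
def IsAtomicWStarSeparable (M : Type*) [Ring M] [StarRing M] [Algebra ℂ M] : Prop :=
  ∃ (ι : Type) (_ : Countable ι) (H : ι → Type)
    (_ : ∀ i, NormedAddCommGroup (H i)) (_ : ∀ i, InnerProductSpace ℂ (H i))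
    (_ : ∀ i, CompleteSpace (H i)) (_ : ∀ i, TopologicalSpace.SeparableSpace (H i))
    (_ : ∀ i, Nontrivial (H i)),
    Nonempty (M ≃⋆ₐ[ℂ] lp (fun i => H i →L[ℂ] H i) ∞)

variable {A : Type*} [CStarAlgebra A] [PartialOrder A] [StarOrderedRing A]

/-- `p` is a projection of the center of `B`. -/
def IsCentralProjection (B : StarSubalgebra ℂ A) (p : A) : Prop :=
  p ∈ B ∧ (∀ x ∈ B, p * x = x * p) ∧ IsStarProjection p

/-- The minimal projections of the center of `B`. -/
def minimalCentralProjections (B : StarSubalgebra ℂ A) : Set A :=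
  {z | IsCentralProjection B z ∧ z ≠ 0 ∧
    ∀ p : A, IsCentralProjection B p → p ≤ z → p = 0 ∨ p = z}

/-- The direct summand `z B` of `B` for a minimal central projection `z`. Its unit is `z`. -/
def summand (B : StarSubalgebra ℂ A) (z : minimalCentralProjections B) :
    NonUnitalStarSubalgebra ℂ A where
  carrier := {x | x ∈ B ∧ (z : A) * x = x}
  add_mem' := fun ha hb => ⟨add_mem ha.1 hb.1, by rw [mul_add, ha.2, hb.2]⟩
  zero_mem' := ⟨zero_mem B, mul_zero _⟩
  mul_mem' := fun ha hb => ⟨mul_mem ha.1 hb.1, by rw [← mul_assoc, ha.2]⟩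
  smul_mem' := fun c _ hx => ⟨B.smul_mem hx.1 c, by rw [mul_smul_comm, hx.2]⟩
  star_mem' := fun {x} hx => ⟨star_mem hx.1, by
    have h := congrArg star hx.2
    rw [star_mul, z.2.1.2.2.isSelfAdjoint.star_eq] at h
    rw [z.2.1.2.1 _ (star_mem hx.1), h]⟩

/-- The element `z b` of `z B`, for `b` in `B`. -/
def summandMk (B : StarSubalgebra ℂ A) (z : minimalCentralProjections B) (b : A) (hb : b ∈ B) :
    summand B z :=
  ⟨(z : A) * b, mul_mem z.2.1.1 hb, by
    rw [← mul_assoc, z.2.1.2.2.isIdempotentElem.eq]⟩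

/-- The unit `z` of `z B`. -/
def summandUnit (B : StarSubalgebra ℂ A) (z : minimalCentralProjections B) : summand B z :=
  ⟨(z : A), z.2.1.1, z.2.1.2.2.isIdempotentElem.eq⟩

/-! ### The inductive system and the flow -/

variable (A) in
/-- `A` as the inductive limit C*-algebra of a sequence `A_0 = ℂ 1 ⊆ A_1 ⊆ A_2 ⊆ ⋯` of atomic
W*-algebras with separable predual and normal (unital) inclusions. -/
structure AtomicSystem where
  /-- The algebras `A_n`. -/
  alg : ℕ → StarSubalgebra ℂ A
  alg_zero : alg 0 = ⊥
  le_succ : ∀ n, alg n ≤ alg (n + 1)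
  dense_iUnion : Dense (⋃ n, (alg n : Set A))
  atomic : ∀ n, IsAtomicWStarSeparable (alg n)
  normal_inclusion : ∀ n, IsNormalMap (StarSubalgebra.inclusion (le_succ n))

/-- An inductive flow: an action `α` of `ℝ` on `A` by `*`-automorphisms with `α_t(A_n) = A_n`, whose
restriction to each `A_n` satisfies `‖ω ∘ α_t - ω‖ → 0` as `t → 0` for each normal `ω`. -/
structure InductiveFlow (S : AtomicSystem A) where
  /-- The action; its value at `t` is `α_t`. -/
  aut : Multiplicative ℝ →* (A ≃⋆ₐ[ℂ] A)
  map_alg : ∀ (t : ℝ) (n : ℕ), aut (Multiplicative.ofAdd t) '' (S.alg n : Set A) = S.alg n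
  continuous_on_predual : ∀ (n : ℕ), ∀ ω ∈ predual (S.alg n), ∀ ε > 0, ∀ᶠ t in 𝓝 (0 : ℝ),
    ∀ a : S.alg n, ‖ω ⟨aut (Multiplicative.ofAdd t) a,
      (map_alg t n).subset (Set.mem_image_of_mem _ a.2)⟩ - ω a‖ ≤ ε * ‖a‖

namespace InductiveFlow

variable {S : AtomicSystem A} (α : InductiveFlow S)

/-- The automorphism `α_t`. -/
def at' (t : ℝ) : A → A := α.aut (Multiplicative.ofAdd t)

theorem at'_mem (t : ℝ) (n : ℕ) {a : A} (ha : a ∈ S.alg n) : α.at' t a ∈ S.alg n :=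
  (α.map_alg t n).subset (Set.mem_image_of_mem _ ha)

end InductiveFlow

/-- The set of minimal central projections of `A_n`: the vertices of level `n`. -/
abbrev Vertex (S : AtomicSystem A) (n : ℕ) : Type _ := minimalCentralProjections (S.alg n)

/-- The graded vertex set, the disjoint union of the levels. -/
abbrev GradedVertex (S : AtomicSystem A) : Type _ := Σ n : ℕ, Vertex S n

/-- The unit of `A` is a minimal projection of the center of `A_0 = ℂ 1`. -/
theorem one_mem_vertex_zero [Nontrivial A] (S : AtomicSystem A) :
    (1 : A) ∈ minimalCentralProjections (S.alg 0) := by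
  refine ⟨⟨one_mem _, fun x _ => by rw [one_mul, mul_one], IsStarProjection.one _⟩, one_ne_zero, ?_⟩
  rintro p ⟨hp, -, hproj⟩ -
  rw [S.alg_zero, StarSubalgebra.mem_bot] at hp
  obtain ⟨c, rfl⟩ := hp
  have h := hproj.isIdempotentElem.eq
  rw [← map_mul] at h
  have hc : c * c = c := (algebraMap ℂ A).injective h
  rcases IsIdempotentElem.iff_eq_zero_or_one.mp hc with h0 | h1
  · left; rw [h0, map_zero]
  · right; rw [h1, map_one]

/-- The root `1` of the graded vertex set. -/
def root [Nontrivial A] (S : AtomicSystem A) : GradedVertex S := ⟨0, 1, one_mem_vertex_zero S⟩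

section KMS

variable {S : AtomicSystem A} (α : InductiveFlow S) (β : ℝ)

/-- The local flow on `z A_n`, the restriction of `α` to `z A_n`. The continuity of `α` forces
`α_t(z) = z`, so that `α_t(x) = z α_t(x)` for `x` in `z A_n`; the factor `z` only makes it
visible that the value lies in `z A_n`. -/
def localFlow {n : ℕ} (z : Vertex S n) (t : ℝ) (x : summand (S.alg n) z) : summand (S.alg n) z :=
  summandMk (S.alg n) z (α.at' t x) (α.at'_mem t n x.2.1)

/-- The normal KMS states of the local flow on `z A_n`. -/
def localKMS {n : ℕ} (z : Vertex S n) : Set (summand (S.alg n) z →L[ℂ] ℂ) :=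
  {τ | IsStateWithUnit (summandUnit (S.alg n) z) τ ∧ IsNormalMap τ ∧ IsKMS (localFlow α z) β τ}

open Classical in
/-- The local Gibbs state: the (unique) normal KMS state of the local flow on `z A_n` if there is
one, and `0` otherwise. -/
def gibbs {n : ℕ} (z : Vertex S n) : summand (S.alg n) z →L[ℂ] ℂ :=
  if h : (localKMS α β z).Nonempty then h.some else 0

/-- The link `κ(z, z') = τ_z(z z')` for `z` in level `n` and `z'` in level `m < n`, where `τ_z` is
the local Gibbs state. It is `0` if there is no normal KMS state on `z A_n`. -/
def link {m n : ℕ} (hmn : m < n) (z : Vertex S n) (z' : Vertex S m) : ℂ :=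
  gibbs α β z (summandMk (S.alg n) z z' (monotone_nat_of_le_succ S.le_succ hmn.le z'.2.1.1))

/-- Harmonic functions for the link: `ν(z') = ∑_z ν(z) κ(z, z')`, where `z` runs over level
`n + 1`, for each `z'` in level `n`. The convergence of the sum is part of the condition. -/
def IsHarmonic (ν : GradedVertex S → ℂ) : Prop :=
  ∀ (n : ℕ) (z' : Vertex S n),
    HasSum (fun z : Vertex S (n + 1) => ν ⟨n + 1, z⟩ * link α β n.lt_succ_self z z') (ν ⟨n, z'⟩)

/-- The normalized positive harmonic functions, with the topology of pointwise convergence (the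
subspace topology from the product `GradedVertex S → ℂ`). -/
def normalizedPositiveHarmonic [Nontrivial A] : Set (GradedVertex S → ℂ) :=
  {ν | IsHarmonic α β ν ∧ (∀ z, 0 ≤ ν z) ∧ ν (root S) = 1}

/-- The locally normal KMS states on `A`, with the weak* topology: the states that satisfy the KMS
condition on `A` and whose restriction to each `A_n` is normal. -/
def locallyNormalKMS : Set (WeakDual ℂ A) :=
  {ω | IsStateWithUnit (1 : A) ω ∧ IsKMS α.at' β ω ∧
    ∀ n : ℕ, IsNormalMap (fun a : S.alg n => ω a)}

end KMS

end InductiveKMS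

end

set_option linter.unusedSectionVars false

open scoped ComplexOrder ENNReal Topology

noncomputable section

namespace InductiveKMS

section


/-! ### Bounded holomorphic functions on a strip -/

/-! A normal KMS functional on `A_n` is determined by its masses at the minimal central projections:
on each summand it is a multiple of the local Gibbs state, and by normality the summands exhaust it.
Hence a locally normal KMS state ω expands on `A_n` as ∑ ω(z) τ_z
(`IsKMSFunctional.hasSum_gibbsFunctional`). The expansion on `A_{n+1}`, evaluated at a vertex of
level n, is the harmonicity of ν[ω]; the expansions on all levels, with density, give injectivity.

Conversely, a normalized positive harmonic ν has total mass one on every level, so ∑ ν(z) τ_z is a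
normal KMS state on `A_n`. Harmonicity says that the functional of level n + 1 has the masses ν(z')
on level n, so by uniqueness the functionals of different levels are consistent
(`superposition_levelIncl`) and extend to `A`. The KMS condition survives both the infinite sums and
the passage to the norm closure, because the maximum principle turns uniform convergence of boundary
values into uniform convergence on the strip. Pointwise convergence of the level measures implies
convergence against bounded functions by Scheffé's lemma, which makes the inverse continuous.

The core is uniqueness on a summand, which is some B(H) (`eq_of_isKMS`). It needs neither a
Hamiltonian nor a unitary implementation of the flow. Positive functionals φ, ψ have densities ρ, σ
with φ(|w⟩⟨v|) = ⟨ρv, w⟩. For β ≠ 0 KMS functionals are invariant, so σ is fixed by the flow and the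
KMS condition makes ρ and σ commute; at β = 0 this is the trace property. Two strip functions with
equal values on the line Im w = β then give ρxσ = σxρ for all x. Operators x of rank one show that ρ
and σ are proportional, and normality and the equal masses finish the proof. -/

/-- `f` and `g` are the boundary values of a bounded continuous function on the closed strip that is
holomorphic in its interior. -/
def HasStripExtension (β : ℝ) (f g : ℝ → ℂ) : Prop :=
  ∃ F : ℂ → ℂ, ContinuousOn F (closedStrip β) ∧ (∃ C : ℝ, ∀ w ∈ closedStrip β, ‖F w‖ ≤ C) ∧
    DifferentiableOn ℂ F (openStrip β) ∧ ∀ t : ℝ, F t = f t ∧ F (t + Complex.I * β) = g t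

theorem ofReal_mem_closedStrip (β t : ℝ) : (t : ℂ) ∈ closedStrip β := by
  simp [closedStrip]

theorem add_I_mul_mem_closedStrip (β t : ℝ) : (t + Complex.I * β : ℂ) ∈ closedStrip β := by
  simp [closedStrip]

theorem closedStrip_eq_preimage (β : ℝ) :
    closedStrip β = Complex.im ⁻¹' Set.Icc (min 0 β) (max 0 β) := rfl

theorem openStrip_eq_preimage (β : ℝ) :
    openStrip β = Complex.im ⁻¹' Set.Ioo (min 0 β) (max 0 β) := rfl

theorem min_lt_max_of_ne_zero {β : ℝ} (hβ : β ≠ 0) : min 0 β < max 0 β :=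
  min_lt_max.2 hβ.symm

theorem closure_openStrip {β : ℝ} (hβ : β ≠ 0) : closure (openStrip β) = closedStrip β := by
  rw [openStrip_eq_preimage, Complex.closure_preimage_im,
    closure_Ioo (min_lt_max_of_ne_zero hβ).ne, closedStrip_eq_preimage]

theorem isOpen_openStrip (β : ℝ) : IsOpen (openStrip β) :=
  isOpen_Ioo.preimage Complex.continuous_im

theorem openStrip_subset (β : ℝ) : openStrip β ⊆ closedStrip β := fun _ hw => ⟨hw.1.le, hw.2.le⟩

/-- The maximum principle on a strip: the boundary values bound the function. -/
theorem norm_le_of_boundary {β : ℝ} {F : ℂ → ℂ} {C : ℝ} (hc : ContinuousOn F (closedStrip β))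
    (hb : ∃ C : ℝ, ∀ w ∈ closedStrip β, ‖F w‖ ≤ C) (hd : DifferentiableOn ℂ F (openStrip β))
    (h0 : ∀ t : ℝ, ‖F t‖ ≤ C) (h1 : ∀ t : ℝ, ‖F (t + Complex.I * β)‖ ≤ C) :
    ∀ w ∈ closedStrip β, ‖F w‖ ≤ C := by
  have e0 : ∀ w : ℂ, w.im = 0 → ‖F w‖ ≤ C := fun w hw => by
    have : w = (w.re : ℂ) := Complex.ext (by simp) (by simp [hw])
    rw [this]; exact h0 _
  have e1 : ∀ w : ℂ, w.im = β → ‖F w‖ ≤ C := fun w hw => by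
    have : w = (w.re : ℂ) + Complex.I * β := Complex.ext (by simp) (by simp [hw])
    rw [this]; exact h1 _
  intro w hw
  rcases eq_or_ne β 0 with rfl | hβ
  · exact e0 w (by simpa [closedStrip, and_comm, ← le_antisymm_iff] using hw)
  have hboundary : ∀ w : ℂ, w.im = min 0 β ∨ w.im = max 0 β → ‖F w‖ ≤ C := by
    intro w hw
    rcases le_total 0 β with h | h <;> simp only [h, min_eq_left, min_eq_right, max_eq_left,
      max_eq_right] at hw <;> rcases hw with hw | hw <;> first | exact e0 w hw | exact e1 w hw
  obtain ⟨K, hK⟩ := hb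
  refine PhragmenLindelof.horizontal_strip (a := min 0 β) (b := max 0 β) ⟨hd, ?_⟩
    ⟨0, div_pos Real.pi_pos (sub_pos.2 (min_lt_max_of_ne_zero hβ)), 0, ?_⟩
    (fun z hz => hboundary z (.inl hz)) (fun z hz => hboundary z (.inr hz)) hw.1 hw.2
  · have := closure_openStrip hβ
    rw [openStrip_eq_preimage] at this
    rwa [this]
  · refine Asymptotics.IsBigO.of_bound K (Filter.eventually_inf_principal.2
      (Filter.Eventually.of_forall fun z hz => ?_))
    simpa using hK z (openStrip_subset β hz)

namespace HasStripExtension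

variable {β : ℝ} {f g f' g' : ℝ → ℂ}

theorem add (h : HasStripExtension β f g) (h' : HasStripExtension β f' g') :
    HasStripExtension β (fun t => f t + f' t) (fun t => g t + g' t) := by
  obtain ⟨F, hc, ⟨C, hC⟩, hd, hb⟩ := h
  obtain ⟨F', hc', ⟨C', hC'⟩, hd', hb'⟩ := h'
  exact ⟨fun w => F w + F' w, hc.add hc',
    ⟨C + C', fun w hw => (norm_add_le _ _).trans (add_le_add (hC w hw) (hC' w hw))⟩, hd.add hd',
    fun t => ⟨by simp only [(hb t).1, (hb' t).1], by simp only [(hb t).2, (hb' t).2]⟩⟩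

theorem const_mul (c : ℂ) (h : HasStripExtension β f g) :
    HasStripExtension β (fun t => c * f t) (fun t => c * g t) := by
  obtain ⟨F, hc, ⟨C, hC⟩, hd, hb⟩ := h
  refine ⟨fun w => c * F w, continuousOn_const.mul hc, ⟨‖c‖ * C, fun w hw => ?_⟩,
    hd.const_mul c, fun t => ⟨by simp only [(hb t).1], by simp only [(hb t).2]⟩⟩
  rw [norm_mul]
  exact mul_le_mul_of_nonneg_left (hC w hw) (norm_nonneg c)

theorem const (c : ℂ) : HasStripExtension β (fun _ => c) (fun _ => c) :=
  ⟨fun _ => c, continuousOn_const, ⟨‖c‖, fun _ _ => le_rfl⟩, differentiableOn_const c,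
    fun _ => ⟨rfl, rfl⟩⟩

theorem sub (h : HasStripExtension β f g) (h' : HasStripExtension β f' g') :
    HasStripExtension β (fun t => f t - f' t) (fun t => g t - g' t) := by
  simpa [sub_eq_add_neg] using h.add (h'.const_mul (-1))

theorem sum {ι : Type*} (s : Finset ι) {f g : ι → ℝ → ℂ}
    (h : ∀ i ∈ s, HasStripExtension β (f i) (g i)) :
    HasStripExtension β (fun t => ∑ i ∈ s, f i t) (fun t => ∑ i ∈ s, g i t) := by
  classical
  induction s using Finset.induction_on with
  | empty => simpa using const 0
  | insert i s hi ih =>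
    simp only [Finset.sum_insert hi]
    exact (h i (by simp)).add (ih fun j hj => h j (by simp [hj]))

/-- A strip function that vanishes on the line `Im w = β` vanishes on the real line. -/
theorem eq_zero_of_upper_eq_zero (h : HasStripExtension β f fun _ => 0) (t : ℝ) : f t = 0 := by
  obtain ⟨F, hc, ⟨C, hC⟩, hd, hb⟩ := h
  rcases eq_or_ne β 0 with rfl | hβ
  · have := (hb t).2
    rw [← (hb t).1]; simpa using this
  -- The damping factor has modulus exp(l · Im w / β): it is 1 on the real line, and its growth on
  -- the other line is harmless because F vanishes there. Letting l tend to infinity kills F in the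
  -- interior.
  have key : ∀ l : ℝ, 0 ≤ l → ∀ w ∈ closedStrip β,
      ‖Complex.exp (-(Complex.I * l * w / β)) * F w‖ ≤ C := by
    intro l hl
    have hn : ∀ w : ℂ, ‖Complex.exp (-(Complex.I * l * w / β))‖ = Real.exp (l * (w.im / β)) := by
      intro w
      rw [Complex.norm_exp]
      congr 1
      have : -(Complex.I * l * w / β) = ((l / β : ℝ) : ℂ) * (-(Complex.I * w)) := by
        push_cast; ring
      rw [this, Complex.re_ofReal_mul]
      simp; ring
    have hre : ∀ w ∈ closedStrip β, w.im / β ≤ 1 := by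
      intro w hw
      rcases hβ.lt_or_gt with h | h
      · rw [div_le_one_of_neg h]
        simpa [h.le] using hw.1
      · rw [div_le_one h]
        simpa [h.le] using hw.2
    have hC0 : 0 ≤ C := (norm_nonneg _).trans (hC 0 (by simpa using ofReal_mem_closedStrip β 0))
    refine norm_le_of_boundary ((by fun_prop : Continuous _).continuousOn.mul hc)
      ⟨Real.exp l * C, fun w hw => ?_⟩ ((by fun_prop : Differentiable ℂ _).differentiableOn.mul hd)
      (fun s => ?_) (fun s => ?_)
    · rw [norm_mul, hn]
      gcongr
      · exact mul_le_of_le_one_right hl (hre w hw)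
      · exact hC w hw
    · rw [norm_mul, hn]
      simpa using hC s (ofReal_mem_closedStrip β s)
    · rw [(hb s).2]; simpa using hC0
  have hin : ∀ w ∈ openStrip β, F w = 0 := by
    intro w hw
    have hpos : 0 < w.im / β := by
      rcases hβ.lt_or_gt with h | h
      · exact div_pos_of_neg_of_neg (by simpa [h.le] using hw.2) h
      · exact div_pos (by simpa [h.le] using hw.1) h
    by_contra hne
    have hne' : 0 < ‖F w‖ := norm_pos_iff.2 hne
    obtain ⟨l, hl⟩ := exists_nat_gt (C / ‖F w‖ / (w.im / β))
    have h1 := key l (Nat.cast_nonneg l) w (openStrip_subset β hw)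
    have : -(Complex.I * (l : ℝ) * w / β) = (((l : ℝ) / β : ℝ) : ℂ) * (-(Complex.I * w)) := by
      push_cast; ring
    rw [norm_mul, Complex.norm_exp, this, Complex.re_ofReal_mul] at h1
    rw [div_lt_iff₀ hpos, div_lt_iff₀ hne'] at hl
    have h2 : (l : ℝ) * (w.im / β) < Real.exp ((l : ℝ) / β * (-(Complex.I * w)).re) := by
      have : (l : ℝ) / β * (-(Complex.I * w)).re = l * (w.im / β) := by simp; ring
      rw [this]
      linarith [Real.add_one_le_exp ((l : ℝ) * (w.im / β))]
    nlinarith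
  have := Set.EqOn.of_subset_closure (f := F) (g := fun _ => 0) hin hc continuousOn_const
    (openStrip_subset β) (closure_openStrip hβ).ge (ofReal_mem_closedStrip β t)
  rw [← (hb t).1, this]

theorem eq_of_upper_eq (h : HasStripExtension β f g) (h' : HasStripExtension β f' g) (t : ℝ) :
    f t = f' t := by
  refine sub_eq_zero.1 (eq_zero_of_upper_eq_zero (β := β) (f := fun t => f t - f' t) ?_ t)
  simpa using h.sub h'

/-- A strip function with real boundary values is constant. -/
theorem eq_of_real (hβ : β ≠ 0) (h : HasStripExtension β f g) (hf : ∀ t, (f t).im = 0)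
    (hg : ∀ t, (g t).im = 0) (s t : ℝ) : f s = f t := by
  obtain ⟨F, hc, ⟨C, hC⟩, hd, hb⟩ := h
  -- Both exponentials exp(±iF) have modulus 1 on the boundary, hence at most 1 inside, which forces
  -- Im F = 0.
  have key : ∀ c : ℝ, |c| = 1 → ∀ w ∈ closedStrip β, ‖Complex.exp (c * Complex.I * F w)‖ ≤ 1 := by
    intro c hc1
    have hn : ∀ w, ‖Complex.exp (c * Complex.I * F w)‖ = Real.exp (-c * (F w).im) := by
      intro w
      rw [Complex.norm_exp, mul_assoc, Complex.re_ofReal_mul]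
      simp
    refine norm_le_of_boundary (continuousOn_const.mul hc).cexp ⟨Real.exp C, fun w hw => ?_⟩
      (hd.const_mul _).cexp (fun t => ?_) (fun t => ?_)
    · rw [hn, Real.exp_le_exp]
      refine (le_abs_self _).trans ?_
      rw [abs_mul, abs_neg, hc1, one_mul]
      exact (Complex.abs_im_le_norm _).trans (hC w hw)
    · rw [hn, (hb t).1, hf]; simp
    · rw [hn, (hb t).2, hg]; simp
  have him : ∀ w ∈ closedStrip β, (F w).im = 0 := by
    intro w hw
    have h1 := key 1 (by simp) w hw
    have h2 := key (-1) (by simp) w hw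
    rw [Complex.norm_exp, Real.exp_le_one_iff] at h1 h2
    simp at h1 h2
    exact le_antisymm h2 h1
  have hpre : IsPreconnected (openStrip β) := by
    rw [openStrip_eq_preimage]
    exact ((convex_Ioo _ _).is_linear_preimage
      (Complex.imLm.isLinear)).isPreconnected
  have hne : (openStrip β).Nonempty := by
    obtain ⟨y, hy⟩ := exists_between (min_lt_max_of_ne_zero hβ)
    exact ⟨⟨0, y⟩, hy⟩
  -- Open mapping theorem: the image of F lies in the real line, which contains no disc.
  have hconst : ∃ c, ∀ w ∈ openStrip β, F w = c := by
    refine ((hd.analyticOnNhd (isOpen_openStrip β)).is_constant_or_isOpen hpre).resolve_right ?_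
    intro hop
    have ho := hop _ subset_rfl (isOpen_openStrip β)
    obtain ⟨w, hw⟩ := hne
    obtain ⟨ε, hε, hball⟩ := Metric.isOpen_iff.1 ho (F w) ⟨w, hw, rfl⟩
    have : F w + (ε / 2 : ℝ) * Complex.I ∈ Metric.ball (F w) ε := by
      simp [abs_of_pos hε]
      linarith
    obtain ⟨v, hv, hve⟩ := hball this
    have h1 := him v (openStrip_subset β hv)
    rw [hve] at h1
    have h2 := him w (openStrip_subset β hw)
    simp [h2] at h1
    exact hε.ne' h1
  obtain ⟨c, hc'⟩ := hconst
  have := Set.EqOn.of_subset_closure (f := F) (g := fun _ => c) hc' hc continuousOn_const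
    (openStrip_subset β) (closure_openStrip hβ).ge
  rw [← (hb s).1, ← (hb t).1, this (ofReal_mem_closedStrip β s), this (ofReal_mem_closedStrip β t)]

/-- Uniform limits of boundary values of strip functions are boundary values of strip functions. -/
theorem of_tendstoUniformly {ι : Type*} {l : Filter ι} [l.NeBot] {f g : ι → ℝ → ℂ}
    {f₀ g₀ : ℝ → ℂ} (h : ∀ i, HasStripExtension β (f i) (g i)) (hf : TendstoUniformly f f₀ l)
    (hg : TendstoUniformly g g₀ l) : HasStripExtension β f₀ g₀ := by
  choose F hc hC hd hb using h
  -- The maximum principle, applied to differences, carries the uniform Cauchy property from the two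
  -- boundary lines to the strip.
  have hcauchy : UniformCauchySeqOn F l (closedStrip β) := by
    intro u hu
    obtain ⟨ε, hε, hεu⟩ := Metric.mem_uniformity_dist.1 hu
    have e1 := (tendstoUniformlyOn_univ.2 hf).uniformCauchySeqOn _
      (Metric.dist_mem_uniformity (half_pos hε))
    have e2 := (tendstoUniformlyOn_univ.2 hg).uniformCauchySeqOn _
      (Metric.dist_mem_uniformity (half_pos hε))
    filter_upwards [e1, e2] with p hp1 hp2 w hw
    refine hεu (lt_of_le_of_lt ?_ (half_lt_self hε))
    rw [dist_eq_norm]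
    refine norm_le_of_boundary ((hc p.1).sub (hc p.2)) ?_ ((hd p.1).sub (hd p.2))
      (fun t => ?_) (fun t => ?_) w hw
    · obtain ⟨C₁, h₁⟩ := hC p.1
      obtain ⟨C₂, h₂⟩ := hC p.2
      exact ⟨C₁ + C₂, fun w hw => (norm_sub_le _ _).trans (add_le_add (h₁ w hw) (h₂ w hw))⟩
    · have := (hp1 t (Set.mem_univ t)).le
      simp only [Pi.sub_apply, (hb _ t).1]
      rwa [← dist_eq_norm]
    · have := (hp2 t (Set.mem_univ t)).le
      simp only [Pi.sub_apply, (hb _ t).2]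
      rwa [← dist_eq_norm]
  have hlim : ∀ w, ∃ v, w ∈ closedStrip β → Filter.Tendsto (fun i => F i w) l (𝓝 v) := by
    intro w
    by_cases hw : w ∈ closedStrip β
    · obtain ⟨v, hv⟩ := cauchy_map_iff_exists_tendsto.1 (hcauchy.cauchy_map hw)
      exact ⟨v, fun _ => hv⟩
    · exact ⟨0, fun h => absurd h hw⟩
  choose G hG using hlim
  have hu : TendstoUniformlyOn F G l (closedStrip β) :=
    hcauchy.tendstoUniformlyOn_of_tendsto fun w hw => hG w hw
  refine ⟨G, hu.continuousOn (Filter.Eventually.of_forall hc).frequently, ?_, ?_, fun t => ⟨?_, ?_⟩⟩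
  · obtain ⟨i, hi⟩ := (hu _ (Metric.dist_mem_uniformity one_pos)).exists
    obtain ⟨C, hC⟩ := hC i
    refine ⟨1 + C, fun w hw => ?_⟩
    have h1 : dist (G w) (F i w) < 1 := hi w hw
    rw [dist_eq_norm] at h1
    calc ‖G w‖ = ‖(G w - F i w) + F i w‖ := by rw [sub_add_cancel]
      _ ≤ _ := (norm_add_le _ _).trans (add_le_add h1.le (hC w hw))
  · exact (hu.mono (openStrip_subset β)).tendstoLocallyUniformlyOn.differentiableOn
      (Filter.Eventually.of_forall hd) (isOpen_openStrip β)
  · refine tendsto_nhds_unique (hG t (ofReal_mem_closedStrip β t)) ?_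
    simp only [(hb _ t).1]
    exact hf.tendsto_at t
  · refine tendsto_nhds_unique (hG _ (add_I_mul_mem_closedStrip β t)) ?_
    simp only [(hb _ t).2]
    exact hg.tendsto_at t

end HasStripExtension

end

section


/-! ### Positive functionals -/

namespace IsPositiveFunctional

section Algebraic

variable {M : Type*} [Ring M] [StarRing M] [Algebra ℂ M] [StarModule ℂ M] {f : M →ₗ[ℂ] ℂ}

/-- Polarization: positivity at x, y, x + y and x + iy makes the imaginary parts vanish, which gives
the two real equations needed. -/
theorem star_mul_symm (hf : IsPositiveFunctional f) (x y : M) :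
    star (f (star y * x)) = f (star x * y) := by
  have h1 := Complex.nonneg_iff.1 (hf (x + y))
  have h2 := Complex.nonneg_iff.1 (hf (x + Complex.I • y))
  have hx := Complex.nonneg_iff.1 (hf x)
  have hy := Complex.nonneg_iff.1 (hf y)
  simp only [star_add, star_smul, add_mul, mul_add, map_add, smul_mul_assoc, mul_smul_comm,
    map_smul, Complex.add_im, smul_eq_mul] at h1 h2
  simp at h2
  refine Complex.ext ?_ ?_ <;> simp <;> linarith [h1.2, h2.2, hx.2, hy.2]

theorem map_star (hf : IsPositiveFunctional f) (x : M) : f (star x) = star (f x) := by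
  simpa using (hf.star_mul_symm x 1).symm

/-- Cauchy–Schwarz for the semi-inner product (x, y) ↦ f(x* y). -/
theorem norm_sq_le (hf : IsPositiveFunctional f) (x y : M) :
    ‖f (star y * x)‖ ^ 2 ≤ (f (star x * x)).re * (f (star y * y)).re := by
  let c : PreInnerProductSpace.Core ℂ M :=
    { inner := fun x y => f (star x * y)
      conj_inner_symm := fun x y => hf.star_mul_symm x y
      re_inner_nonneg := fun x => (Complex.nonneg_iff.1 (hf x)).1
      add_left := fun x y z => by simp [add_mul]
      smul_left := fun x y r => by simp }
  have := @InnerProductSpace.Core.inner_mul_inner_self_le ℂ M _ _ _ c x y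
  have h1 : ‖f (star x * y)‖ = ‖f (star y * x)‖ := by
    rw [← hf.star_mul_symm x y, norm_star]
  have h2 : ‖f (star x * y)‖ * ‖f (star y * x)‖ ≤ (f (star x * x)).re * (f (star y * y)).re := this
  rw [sq]
  rwa [h1] at h2

theorem map_projection_nonneg (hf : IsPositiveFunctional f) {p : M} (hp : IsStarProjection p) :
    0 ≤ f p := by
  simpa [hp.isSelfAdjoint.star_eq, hp.isIdempotentElem.eq] using hf p

theorem norm_sq_projection_mul_le (hf : IsPositiveFunctional f) {p : M} (hp : IsStarProjection p)
    (x : M) : ‖f (p * x)‖ ^ 2 ≤ (f (star x * x)).re * (f p).re := by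
  simpa [hp.isSelfAdjoint.star_eq, hp.isIdempotentElem.eq] using hf.norm_sq_le x p

theorem map_projection_mul_eq_zero (hf : IsPositiveFunctional f) {p : M} (hp : IsStarProjection p)
    (h : f p = 0) (x : M) : f (p * x) = 0 := by
  have := hf.norm_sq_projection_mul_le hp x
  rw [h] at this
  simpa using (this.antisymm (by simp : _ ≤ _))

/-- If projections `p i` exhaust the mass of a positive functional, then `p i * x` converges to `x`
in the eyes of the functional. -/
theorem tendsto_projection_mul (hf : IsPositiveFunctional f) {ι : Type*} {l : Filter ι}
    {p : ι → M} (hp : ∀ i, IsStarProjection (p i))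
    (h : Filter.Tendsto (fun i => f (p i)) l (𝓝 (f 1))) (x : M) :
    Filter.Tendsto (fun i => f (p i * x)) l (𝓝 (f x)) := by
  have hb : ∀ i, ‖f (p i * x) - f x‖ ^ 2 ≤ (f (star x * x)).re * (f 1 - f (p i)).re := by
    intro i
    have := hf.norm_sq_projection_mul_le (hp i).one_sub x
    rwa [sub_mul, one_mul, map_sub, map_sub, norm_sub_rev] at this
  have h0 : Filter.Tendsto (fun i => (f (star x * x)).re * (f 1 - f (p i)).re) l (𝓝 0) := by
    have := (Complex.continuous_re.tendsto _).comp (h.const_sub (f 1))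
    simpa using this.const_mul (f (star x * x)).re
  have h1 : Filter.Tendsto (fun i => ‖f (p i * x) - f x‖ ^ 2) l (𝓝 0) :=
    squeeze_zero (fun i => by positivity) hb h0
  rw [tendsto_iff_norm_sub_tendsto_zero]
  have := h1.sqrt
  simpa [Real.sqrt_sq] using this

end Algebraic

section CStar

variable {M : Type*} [CStarAlgebra M] [PartialOrder M] [StarOrderedRing M] {f : M →ₗ[ℂ] ℂ}

theorem map_nonneg (hf : IsPositiveFunctional f) {x : M} (hx : 0 ≤ x) : 0 ≤ f x := by
  obtain ⟨y, rfl⟩ := CStarAlgebra.nonneg_iff_eq_star_mul_self.1 hx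
  exact hf y

theorem monotone (hf : IsPositiveFunctional f) : Monotone f := fun x y hxy => by
  simpa using hf.map_nonneg (sub_nonneg.2 hxy)

/-- Cauchy–Schwarz against 1, with x* x ≤ ‖x‖². Positive functionals are thus automatically bounded,
so plain linear maps can be used throughout. -/
theorem norm_le (hf : IsPositiveFunctional f) (x : M) : ‖f x‖ ≤ (f 1).re * ‖x‖ := by
  have h1 : (0 : ℂ) ≤ f 1 := by simpa using hf 1
  have h1' := (Complex.nonneg_iff.1 h1).1
  have h2 : (f (star x * x)).re ≤ ‖x‖ ^ 2 * (f 1).re := by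
    have := (Complex.le_def.1 (hf.monotone (CStarAlgebra.star_mul_le_algebraMap_norm_sq (a := x)))).1
    have e : (algebraMap ℝ M) (‖x‖ ^ 2) = ((‖x‖ ^ 2 : ℝ) : ℂ) • (1 : M) := by
      rw [Algebra.algebraMap_eq_smul_one, Complex.coe_smul]
    rwa [e, map_smul, smul_eq_mul, Complex.re_ofReal_mul] at this
  have h3 := hf.norm_sq_le x 1
  simp only [star_one, one_mul] at h3
  refine abs_le_of_sq_le_sq' ?_ (by positivity) |>.2
  nlinarith

end CStar

end IsPositiveFunctional

/-! ### Normal maps -/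

namespace IsNormalMap

variable {M N P : Type*} [Preorder M] [Zero M] [Preorder N] [Zero N] [Preorder P]

theorem comp {g : N → P} {f : M → N} (hg : IsNormalMap g) (hf : IsNormalMap f) (hmono : Monotone f)
    (hpos : ∀ x, 0 ≤ x → 0 ≤ f x) : IsNormalMap (g ∘ f) := by
  intro d x hd hne hdir hx
  rw [Set.image_comp]
  refine hg _ _ ?_ (hne.image f) ?_ (hf d x hd hne hdir hx)
  · rintro _ ⟨y, hy, rfl⟩
    exact hpos y (hd y hy)
  · rintro _ ⟨y, hy, rfl⟩ _ ⟨y', hy', rfl⟩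
    obtain ⟨w, hw, h1, h2⟩ := hdir y hy y' hy'
    exact ⟨f w, ⟨w, hw, rfl⟩, hmono h1, hmono h2⟩

theorem const {c : N} : IsNormalMap (fun _ : M => c) := by
  intro d x hd hne hdir hx
  rw [hne.image_const]
  exact isLUB_singleton

/-- Directedness bounds f y + g y' for independent y, y' in d; the two suprema can then be taken one
after the other. -/
theorem add {f g : M → ℂ} (hf : IsNormalMap f) (hg : IsNormalMap g) (hf' : Monotone f)
    (hg' : Monotone g) : IsNormalMap (fun x => f x + g x) := by
  intro d x hd hne hdir hx
  refine ⟨?_, fun u hu => ?_⟩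
  · rintro _ ⟨y, hy, rfl⟩
    exact add_le_add (hf' (hx.1 hy)) (hg' (hx.1 hy))
  · have h1 : ∀ y ∈ d, ∀ y' ∈ d, f y + g y' ≤ u := by
      intro y hy y' hy'
      obtain ⟨w, hw, h1, h2⟩ := hdir y hy y' hy'
      exact (add_le_add (hf' h1) (hg' h2)).trans (hu ⟨w, hw, rfl⟩)
    have h2 : ∀ y' ∈ d, f x ≤ u - g y' := by
      intro y' hy'
      refine (hf d x hd hne hdir hx).2 ?_
      rintro _ ⟨y, hy, rfl⟩
      exact le_sub_iff_add_le.2 (h1 y hy y' hy')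
    have h3 : g x ≤ u - f x := by
      refine (hg d x hd hne hdir hx).2 ?_
      rintro _ ⟨y, hy, rfl⟩
      exact le_sub_comm.1 (h2 y hy)
    simpa [add_comm] using le_sub_iff_add_le.1 h3

theorem const_mul {f : M → ℂ} (hf : IsNormalMap f) {c : ℂ} (hc : 0 ≤ c) :
    IsNormalMap (fun x => c * f x) := by
  rcases hc.eq_or_lt with rfl | hc
  · simpa using const
  intro d x hd hne hdir hx
  have hci : 0 ≤ c⁻¹ := (inv_pos_of_pos hc).le
  have h := hf d x hd hne hdir hx
  refine ⟨?_, fun u hu => ?_⟩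
  · rintro _ ⟨y, hy, rfl⟩
    exact mul_le_mul_of_nonneg_left (h.1 ⟨y, hy, rfl⟩) hc.le
  · have : f x ≤ c⁻¹ * u := by
      refine h.2 ?_
      rintro _ ⟨y, hy, rfl⟩
      simpa [hc.ne'] using mul_le_mul_of_nonneg_left (hu ⟨y, hy, rfl⟩) hci
    simpa [hc.ne'] using mul_le_mul_of_nonneg_left this hc.le

theorem sum {ι : Type*} (s : Finset ι) {f : ι → M → ℂ} (hf : ∀ i, IsNormalMap (f i))
    (hmono : ∀ i, Monotone (f i)) : IsNormalMap (fun x => ∑ i ∈ s, f i x) := by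
  classical
  induction s using Finset.induction_on with
  | empty => simpa using const
  | insert i s hi ih =>
    simp only [Finset.sum_insert hi]
    exact (hf i).add ih (hmono i) fun x y hxy => Finset.sum_le_sum fun j _ => hmono j hxy

/-- On positive elements the sum is the supremum of its finite partial sums, and suprema commute. -/
theorem hasSum {ι : Type*} {f : ι → M → ℂ} {g : M → ℂ} (hf : ∀ i, IsNormalMap (f i))
    (hmono : ∀ i, Monotone (f i)) (hpos : ∀ i x, 0 ≤ x → 0 ≤ f i x)
    (h : ∀ x, HasSum (fun i => f i x) (g x)) : IsNormalMap g := by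
  intro d x hd hne hdir hx
  have hx0 : 0 ≤ x := by
    obtain ⟨y, hy⟩ := hne
    exact (hd y hy).trans (hx.1 hy)
  refine ⟨?_, fun u hu => ?_⟩
  · rintro _ ⟨y, hy, rfl⟩
    exact hasSum_le (fun i => hmono i (hx.1 hy)) (h y) (h x)
  · refine hasSum_le_of_sum_le (h x) fun s => ?_
    refine ((IsNormalMap.sum s hf hmono) d x hd hne hdir hx).2 ?_
    rintro _ ⟨y, hy, rfl⟩
    exact (sum_le_hasSum s (fun i _ => hpos i y (hd y hy)) (h y)).trans (hu ⟨y, hy, rfl⟩)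

/-- A normal monotone functional converges along an increasing net of positive elements. -/
theorem tendsto {f : M → ℂ} (hf : IsNormalMap f) {ι : Type*} [Preorder ι] [IsDirectedOrder ι]
    [Nonempty ι] {p : ι → M} (hp : Monotone p) (hp0 : ∀ i, 0 ≤ p i) {x : M}
    (hx : IsLUB (Set.range p) x) :
    Filter.Tendsto (fun i => f (p i)) Filter.atTop (𝓝 (f x)) := by
  have hdir : DirectedOn (· ≤ ·) (Set.range p) := by
    rintro _ ⟨i, rfl⟩ _ ⟨j, rfl⟩
    obtain ⟨k, hik, hjk⟩ := exists_ge_ge i j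
    exact ⟨p k, ⟨k, rfl⟩, hp hik, hp hjk⟩
  -- Monotonicity along the net comes from normality itself, applied to the set {p i, p j} with
  -- least upper bound p j.
  have hpair : ∀ {i j}, p i ≤ p j → f (p i) ≤ f (p j) := by
    intro i j hij
    have := hf {p i, p j} (p j) (by rintro y (rfl | rfl) <;> exact hp0 _) ⟨_, .inl rfl⟩ ?_ ?_
    · exact this.1 ⟨p i, .inl rfl, rfl⟩
    · rintro a (rfl | rfl) b (rfl | rfl)
      · exact ⟨p j, .inr rfl, hij, hij⟩
      · exact ⟨p j, .inr rfl, hij, le_rfl⟩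
      · exact ⟨p j, .inr rfl, le_rfl, hij⟩
      · exact ⟨p j, .inr rfl, le_rfl, le_rfl⟩
    · refine ⟨?_, fun u hu => hu (.inr rfl)⟩
      rintro y (rfl | rfl)
      exacts [hij, le_rfl]
  have hlub := hf (Set.range p) x (by rintro _ ⟨i, rfl⟩; exact hp0 i) (Set.range_nonempty p) hdir hx
  have hle : ∀ i, f (p i) ≤ f x := fun i => hlub.1 ⟨p i, ⟨i, rfl⟩, rfl⟩
  have hre : Filter.Tendsto (fun i => (f (p i)).re) Filter.atTop (𝓝 (f x).re) := by
    refine tendsto_atTop_isLUB (fun i j hij => (Complex.le_def.1 (hpair (hp hij))).1) ⟨?_, ?_⟩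
    · rintro _ ⟨i, rfl⟩
      exact (Complex.le_def.1 (hle i)).1
    · intro u hu
      have : f x ≤ ⟨u, (f x).im⟩ := by
        refine hlub.2 ?_
        rintro _ ⟨_, ⟨i, rfl⟩, rfl⟩
        exact Complex.le_def.2 ⟨hu ⟨i, rfl⟩, (Complex.le_def.1 (hle i)).2⟩
      exact (Complex.le_def.1 this).1
  -- Comparable complex numbers have equal imaginary parts, so only the real parts move.
  have him : ∀ i, f (p i) = (f (p i)).re + (f x).im * Complex.I := fun i => by
    rw [← (Complex.le_def.1 (hle i)).2, Complex.re_add_im]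
  have := ((Complex.continuous_ofReal.tendsto _).comp hre).add_const ((f x).im * Complex.I)
  rw [Complex.re_add_im] at this
  refine this.congr fun i => ?_
  exact (him i).symm

end IsNormalMap

end

section


/-! ### Uniqueness of normal KMS functionals on `B(H)` -/

section Hilbert

open InnerProductSpace

variable {H : Type*} [NormedAddCommGroup H] [InnerProductSpace ℂ H] [CompleteSpace H]

theorem mul_rankOne (x : H →L[ℂ] H) (v w : H) :
    x * rankOne ℂ v w = rankOne ℂ (x v) w := by
  ext u; simp

theorem rankOne_mul (x : H →L[ℂ] H) (v w : H) :
    rankOne ℂ v w * x = rankOne ℂ v (star x w) := by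
  ext u
  simp [ContinuousLinearMap.star_eq_adjoint, ContinuousLinearMap.adjoint_inner_left]

theorem star_rankOne (v w : H) : star (rankOne ℂ v w : H →L[ℂ] H) = rankOne ℂ w v := by
  rw [ContinuousLinearMap.star_eq_adjoint, adjoint_rankOne]

theorem rankOne_mul_mul_rankOne (x : H →L[ℂ] H) (v w v' w' : H) :
    rankOne ℂ v w * x * rankOne ℂ v' w' = inner ℂ w (x v') • rankOne ℂ v w' := by
  ext u
  simp [smul_smul, mul_comm]

/-- The operator that represents a bounded functional on `B(H)` on the operators of rank one. -/
def density (φ : (H →L[ℂ] H) →L[ℂ] ℂ) : H →L[ℂ] H :=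
  continuousLinearMapOfBilin
    ((ContinuousLinearMap.compL ℂ H (H →L[ℂ] H) ℂ φ).comp (rankOne ℂ : H →L[ℂ] _).flip)

theorem inner_density (φ : (H →L[ℂ] H) →L[ℂ] ℂ) (v w : H) :
    inner ℂ (density φ v) w = φ (rankOne ℂ w v) := by
  rw [density, continuousLinearMapOfBilin_apply]
  simp

theorem isSelfAdjoint_density {φ : (H →L[ℂ] H) →L[ℂ] ℂ} (hφ : IsPositiveFunctional φ) :
    IsSelfAdjoint (density φ) := by
  rw [ContinuousLinearMap.isSelfAdjoint_iff_isSymmetric]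
  intro v w
  have h1 := IsPositiveFunctional.map_star (f := φ.toLinearMap) hφ (rankOne ℂ v w)
  rw [star_rankOne] at h1
  rw [← inner_conj_symm (v : H)]
  exact (inner_density φ v w).trans (h1.trans (congrArg star (inner_density φ w v).symm))

/-- This describes the diagonal of the density through products and φ alone, so it can be
transported by any automorphism preserving φ. -/
theorem rankOne_mul_density_mul (φ : (H →L[ℂ] H) →L[ℂ] ℂ) (hφ : IsPositiveFunctional φ) (v : H) :
    rankOne ℂ v v * density φ * rankOne ℂ v v = φ (rankOne ℂ v v) • rankOne ℂ v v := by
  rw [rankOne_mul_mul_rankOne, ← inner_density]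
  congr 1
  exact ((ContinuousLinearMap.isSelfAdjoint_iff_isSymmetric.1 (isSelfAdjoint_density hφ)) v v).symm

/-- A self-adjoint operator `p` with `p B(H) p = ℂ p` has the form `c |v⟩⟨v|`. -/
theorem exists_eq_smul_rankOne {p : H →L[ℂ] H} (hp : IsSelfAdjoint p)
    (h : ∀ x : H →L[ℂ] H, ∃ c : ℂ, p * x * p = c • p) : ∃ (c : ℂ) (v : H), p = c • rankOne ℂ v v := by
  by_cases h0 : p = 0
  · exact ⟨0, 0, by simp [h0]⟩
  obtain ⟨u, hu⟩ : ∃ u, p u ≠ 0 := by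
    by_contra! hne
    exact h0 (ContinuousLinearMap.ext hne)
  obtain ⟨c, hc⟩ := h (rankOne ℂ u u)
  rw [mul_rankOne, rankOne_mul, hp.star_eq] at hc
  have hc0 : c ≠ 0 := by
    rintro rfl
    rw [zero_smul] at hc
    exact rankOne_ne_zero hu hu hc
  exact ⟨c⁻¹, p u, by rw [hc, smul_smul, inv_mul_cancel₀ hc0, one_smul]⟩

/-- The density of an invariant functional is invariant. -/
theorem map_density_eq {φ : (H →L[ℂ] H) →L[ℂ] ℂ} (hφ : IsPositiveFunctional φ)
    {γ : (H →L[ℂ] H) → (H →L[ℂ] H)} (hmul : ∀ x y, γ (x * y) = γ x * γ y)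
    (hstar : ∀ x, γ (star x) = star (γ x)) (hsmul : ∀ (c : ℂ) x, γ (c • x) = c • γ x)
    (hbij : Function.Bijective γ) (hinv : ∀ x, φ (γ x) = φ x) : γ (density φ) = density φ := by
  -- Over ℂ an operator is determined by its quadratic form, so the diagonal suffices.
  have key : ∀ v, inner ℂ v (γ (density φ) v) = inner ℂ v (density φ v) := by
    intro v
    rcases eq_or_ne v 0 with rfl | hv
    · simp
    obtain ⟨p, hp⟩ := hbij.2 (rankOne ℂ v v)
    have hsa : IsSelfAdjoint p := hbij.1 (by rw [hstar, hp, star_rankOne])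
    -- The property p B(H) p = ℂ p is preserved by automorphisms, so the preimage of |v⟩⟨v| is again
    -- a multiple of some |w⟩⟨w|; this replaces a unitary implementing γ.
    have hmin : ∀ x : H →L[ℂ] H, ∃ c : ℂ, p * x * p = c • p := fun x =>
      ⟨inner ℂ v (γ x v), hbij.1 (by rw [hmul, hmul, hsmul, hp, rankOne_mul_mul_rankOne])⟩
    obtain ⟨c, w, hcw⟩ := exists_eq_smul_rankOne hsa hmin
    have h1 : p * density φ * p = φ p • p := by
      rw [hcw, smul_mul_assoc, smul_mul_assoc, mul_smul_comm, rankOne_mul_density_mul φ hφ,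
        map_smul, smul_smul, smul_smul, smul_smul, smul_eq_mul]
      congr 1; ring
    have h2 := congrArg γ h1
    rw [hmul, hmul, hsmul, ← hinv p, hp, ← rankOne_mul_density_mul φ hφ, rankOne_mul_mul_rankOne,
      rankOne_mul_mul_rankOne] at h2
    exact smul_left_injective ℂ (rankOne_ne_zero hv hv) h2
  refine ContinuousLinearMap.coe_injective ((ext_inner_map _ _).1 fun v => ?_)
  have := congrArg (starRingEnd ℂ) (key v)
  rwa [inner_conj_symm, inner_conj_symm] at this

theorem isStarProjection_sum_rankOne {ι : Type*} (b : HilbertBasis ι ℂ H) (s : Finset ι) :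
    IsStarProjection (∑ i ∈ s, rankOne ℂ (b i) (b i) : H →L[ℂ] H) := by
  classical
  refine ⟨?_, ?_⟩
  · rw [IsIdempotentElem, Finset.sum_mul]
    refine Finset.sum_congr rfl fun i hi => ?_
    rw [Finset.mul_sum, Finset.sum_eq_single i]
    · rw [mul_rankOne]
      simp [b.orthonormal.1 i]
    · intro j _ hj
      rw [mul_rankOne]
      simp [b.orthonormal.2 hj.symm]
    · exact fun h => absurd hi h
  · rw [IsSelfAdjoint, star_sum]
    exact Finset.sum_congr rfl fun i _ => star_rankOne _ _

/-- Tested on a vector v, an upper bound dominates every partial sum of Parseval's identity, hence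
‖v‖². -/
theorem isLUB_sum_rankOne {ι : Type*} (b : HilbertBasis ι ℂ H) :
    IsLUB (Set.range fun s : Finset ι => (∑ i ∈ s, rankOne ℂ (b i) (b i) : H →L[ℂ] H)) 1 := by
  refine ⟨?_, fun x hx => ?_⟩
  · rintro _ ⟨s, rfl⟩
    exact (isStarProjection_sum_rankOne b s).le_one
  · have hx0 : 0 ≤ x := hx ⟨∅, by simp⟩
    rw [ContinuousLinearMap.nonneg_iff_isPositive] at hx0
    rw [ContinuousLinearMap.le_def, ContinuousLinearMap.isPositive_def']
    refine ⟨hx0.isSelfAdjoint.sub (IsSelfAdjoint.one _), fun v => ?_⟩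
    have h1 : HasSum (fun i => ‖inner ℂ (b i) v‖ ^ 2) (‖v‖ ^ 2) := by
      have := b.hasSum_inner_mul_inner v v
      rw [inner_self_eq_norm_sq_to_K] at this
      have e : (fun i => inner ℂ v (b i) * inner ℂ (b i) v) =
          fun i => ((‖inner ℂ (b i) v‖ ^ 2 : ℝ) : ℂ) := by
        ext i
        rw [← inner_conj_symm, Complex.conj_mul']
        push_cast; rfl
      rw [e] at this
      have h := Complex.hasSum_re this
      simp only [Complex.ofReal_re] at h
      simpa [← Complex.ofReal_pow] using h
    have h2 : ‖v‖ ^ 2 ≤ x.reApplyInnerSelf v := by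
      refine hasSum_le_of_sum_le h1 fun s => ?_
      have h3 := hx ⟨s, rfl⟩
      rw [ContinuousLinearMap.le_def] at h3
      have h4 := h3.re_inner_nonneg_left v
      simp only [sub_apply, inner_sub_left, sum_apply,
        rankOne_apply, sum_inner, inner_smul_left, map_sub, map_sum] at h4
      rw [ContinuousLinearMap.reApplyInnerSelf]
      refine (le_of_eq ?_).trans (sub_nonneg.1 h4)
      refine Finset.sum_congr rfl fun i _ => ?_
      rw [Complex.conj_mul']
      simp [← Complex.ofReal_pow]
    rw [ContinuousLinearMap.reApplyInnerSelf] at h2 ⊢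
    simpa [inner_sub_left, ← Complex.ofReal_pow] using h2

/-- Formally the densities ρ, σ of φ, ψ are multiples of one Gibbs density, for which this identity
is evident. The proof first makes ρ and σ commute and then compares the strip functions of φ(|w⟩⟨v|
σ γ_t(a)) and ψ(|w⟩⟨v| ρ γ_t(a)). Normality plays no role, since only operators of rank one are
evaluated at the end. -/
theorem density_mul_mul_density_eq {β : ℝ} {γ : ℝ → (H →L[ℂ] H) → (H →L[ℂ] H)}
    (hzero : ∀ x, γ 0 x = x) (hadd : ∀ t x y, γ t (x + y) = γ t x + γ t y)
    (hmul : ∀ t x y, γ t (x * y) = γ t x * γ t y)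
    (hstar : ∀ t x, γ t (star x) = star (γ t x)) (hsmul : ∀ t (c : ℂ) x, γ t (c • x) = c • γ t x)
    (hbij : ∀ t, Function.Bijective (γ t)) {φ ψ : (H →L[ℂ] H) →L[ℂ] ℂ}
    (hφ : IsPositiveFunctional φ) (hψ : IsPositiveFunctional ψ) (hφK : IsKMS γ β φ)
    (hψK : IsKMS γ β ψ) (x : H →L[ℂ] H) :
    density φ * x * density ψ = density ψ * x * density φ := by
  have hφs := isSelfAdjoint_density hφ
  have hψs := isSelfAdjoint_density hψ
  have hcomm : density φ * density ψ = density ψ * density φ := by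
    suffices h : ∀ a, φ (density ψ * a) = φ (a * density ψ) by
      ext v
      refine ext_inner_right ℂ fun w => ?_
      have := h (rankOne ℂ w v)
      rw [mul_rankOne, rankOne_mul, ← inner_density, ← inner_density, hψs.star_eq,
        ← ContinuousLinearMap.adjoint_inner_left, ← ContinuousLinearMap.star_eq_adjoint,
        hψs.star_eq] at this
      exact this.symm
    intro a
    rcases eq_or_ne β 0 with rfl | hβ
    -- For β = 0 the two boundary lines coincide, so φ is a trace.
    · obtain ⟨F, -, -, -, hF⟩ := hφK a (density ψ)
      have := hF 0
      rw [hzero] at this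
      rw [← this.1, ← this.2]
      simp
    -- Take b = 1: for self-adjoint y the strip function is real on both lines, hence constant.
    -- General y splits into real and imaginary parts.
    have inv : ∀ {χ : (H →L[ℂ] H) →L[ℂ] ℂ}, IsPositiveFunctional χ → IsKMS γ β χ →
        ∀ t y, χ (γ t y) = χ y := by
      intro χ hχ hχK t y
      have hsa : ∀ y, IsSelfAdjoint y → ∀ t, χ (γ t y) = χ y := by
        intro y hy t
        have him : ∀ t, (χ (γ t y)).im = 0 := fun t => by
          have := IsPositiveFunctional.map_star (f := χ.toLinearMap) hχ (γ t y)
          rw [← hstar, hy.star_eq] at this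
          exact Complex.conj_eq_iff_im.1 this.symm
        have h : HasStripExtension β (fun t => χ (1 * γ t y)) (fun t => χ (γ t y * 1)) := hχK y 1
        simp only [one_mul, mul_one] at h
        rw [h.eq_of_real hβ him him t 0, hzero]
      rw [← realPart_add_I_smul_imaginaryPart y, hadd, hsmul, map_add, map_add, map_smul, map_smul,
        hsa _ (realPart y).2, hsa _ (imaginaryPart y).2]
    have hdens : ∀ t, γ t (density ψ) = density ψ := fun t =>
      map_density_eq hψ (hmul t) (hstar t) (hsmul t) (hbij t) (inv hψ hψK t)
    have h : HasStripExtension β (fun t => φ (density ψ * γ t a)) (fun t => φ (γ t a * density ψ)) :=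
      hφK a (density ψ)
    -- Invariance of φ and of σ makes the upper boundary values constant; a strip function with
    -- constant upper values has the same constant values on the real line.
    have e : (fun t => φ (γ t a * density ψ)) = fun _ => φ (a * density ψ) := by
      ext t
      rw [← inv hφ hφK t (a * density ψ), hmul, hdens]
    rw [e] at h
    have := h.eq_of_upper_eq (.const _) 0
    rwa [hzero] at this
  have hrank : ∀ (w v : H) (a : H →L[ℂ] H),
      φ (rankOne ℂ w v * density ψ * a) = ψ (rankOne ℂ w v * density φ * a) := by
    intro w v a
    have h1 : HasStripExtension β _ _ := hφK a (rankOne ℂ w v * density ψ)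
    have h2 : HasStripExtension β _ _ := hψK a (rankOne ℂ w v * density φ)
    -- The two sides are matrix coefficients involving ρσ and σρ, so the upper boundary values agree
    -- by commutation.
    have e : (fun t => φ (γ t a * (rankOne ℂ w v * density ψ))) =
        fun t => ψ (γ t a * (rankOne ℂ w v * density φ)) := by
      ext t
      rw [rankOne_mul, rankOne_mul, mul_rankOne, mul_rankOne, ← inner_density, ← inner_density,
        hφs.star_eq, hψs.star_eq, ← mul_apply_eq_comp, hcomm,
        mul_apply_eq_comp]
    rw [e] at h1
    have := h1.eq_of_upper_eq h2 0
    rwa [hzero] at this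
  ext v
  refine ext_inner_right ℂ fun w => ?_
  have := hrank w v (star x)
  simp only [rankOne_mul, ← inner_density, star_star, hφs.star_eq, hψs.star_eq] at this
  exact this

/-- Two normal KMS functionals on `B(H)` of the same mass coincide. -/
theorem eq_of_isKMS {β : ℝ} {γ : ℝ → (H →L[ℂ] H) → (H →L[ℂ] H)}
    (hzero : ∀ x, γ 0 x = x) (hadd : ∀ t x y, γ t (x + y) = γ t x + γ t y)
    (hmul : ∀ t x y, γ t (x * y) = γ t x * γ t y)
    (hstar : ∀ t x, γ t (star x) = star (γ t x)) (hsmul : ∀ t (c : ℂ) x, γ t (c • x) = c • γ t x)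
    (hbij : ∀ t, Function.Bijective (γ t)) {φ ψ : (H →L[ℂ] H) →ₗ[ℂ] ℂ}
    (hφ : IsPositiveFunctional φ) (hψ : IsPositiveFunctional ψ) (hφK : IsKMS γ β φ)
    (hψK : IsKMS γ β ψ) {ι : Type*} (b : HilbertBasis ι ℂ H)
    (hφn : Filter.Tendsto (fun s : Finset ι => φ (∑ i ∈ s, rankOne ℂ (b i) (b i))) Filter.atTop
      (𝓝 (φ 1)))
    (hψn : Filter.Tendsto (fun s : Finset ι => ψ (∑ i ∈ s, rankOne ℂ (b i) (b i))) Filter.atTop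
      (𝓝 (ψ 1))) (hone : φ 1 = ψ 1) : φ = ψ := by
  let φ' : (H →L[ℂ] H) →L[ℂ] ℂ := φ.mkContinuous _ hφ.norm_le
  let ψ' : (H →L[ℂ] H) →L[ℂ] ℂ := ψ.mkContinuous _ hψ.norm_le
  have key := density_mul_mul_density_eq (φ := φ') (ψ := ψ') hzero hadd hmul hstar hsmul hbij hφ hψ
    hφK hψK
  by_cases h0 : φ 1 = 0
  · have zero : ∀ {χ : (H →L[ℂ] H) →ₗ[ℂ] ℂ}, IsPositiveFunctional χ → χ 1 = 0 → χ = 0 := by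
      intro χ hχ h
      ext x
      simpa using hχ.map_projection_mul_eq_zero (IsStarProjection.one _) h x
    rw [zero hφ h0, zero hψ (hone ▸ h0)]
  have expand : ∀ (χ : (H →L[ℂ] H) →ₗ[ℂ] ℂ) (s : Finset ι) (a : H →L[ℂ] H),
      χ ((∑ i ∈ s, rankOne ℂ (b i) (b i)) * a) = ∑ i ∈ s, χ (rankOne ℂ (b i) (star a (b i))) := by
    intro χ s a
    simp only [Finset.sum_mul, rankOne_mul, map_sum]
  obtain ⟨c, hc⟩ : ∃ c : ℂ, ∀ v w, φ (rankOne ℂ w v) = c * ψ (rankOne ℂ w v) := by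
    obtain ⟨u, hu⟩ : ∃ u, density ψ' u ≠ 0 := by
      by_contra! hne
      refine h0 (hone.trans (tendsto_nhds_unique hψn ?_))
      have : ∀ v w, ψ (rankOne ℂ w v) = 0 := fun v w => by
        have := inner_density ψ' v w
        rw [hne, inner_zero_left] at this
        exact this.symm
      simp [map_sum, this]
    -- Take x = |w⟩⟨u| in ρxσ = σxρ and apply both sides to the vector σu: then ρw is a multiple of
    -- σw, with a factor independent of w.
    have h1 : ∀ w, inner ℂ (density ψ' u) (density ψ' u) • density φ' w =
        inner ℂ (density φ' u) (density ψ' u) • density ψ' w := by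
      intro w
      have h2 := congrArg (fun T : H →L[ℂ] H => T (density ψ' u)) (key (rankOne ℂ w u))
      simpa only [mul_rankOne, rankOne_mul, (isSelfAdjoint_density (φ := φ') hφ).star_eq,
        (isSelfAdjoint_density (φ := ψ') hψ).star_eq, rankOne_apply] using h2
    have hne : inner ℂ (density ψ' u) (density ψ' u) ≠ (0 : ℂ) := inner_self_ne_zero.2 hu
    refine ⟨starRingEnd ℂ ((inner ℂ (density ψ' u) (density ψ' u))⁻¹ *
      inner ℂ (density φ' u) (density ψ' u)), fun v w => ?_⟩
    have h2 : density φ' v = ((inner ℂ (density ψ' u) (density ψ' u))⁻¹ *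
      inner ℂ (density φ' u) (density ψ' u)) • density ψ' v := by
      rw [mul_smul, ← h1, smul_smul, inv_mul_cancel₀ hne, one_smul]
    have h3 : inner ℂ (density φ' v) w = φ (rankOne ℂ w v) := inner_density φ' v w
    have h4 : inner ℂ (density ψ' v) w = ψ (rankOne ℂ w v) := inner_density ψ' v w
    rw [h2, inner_smul_left, h4] at h3
    exact h3.symm
  -- The finite-rank projections exhaust both functionals, so proportionality on rank one operators
  -- extends to B(H).
  have hfull : ∀ a, φ a = c * ψ a := by
    intro a
    have h1 := hφ.tendsto_projection_mul (fun s => isStarProjection_sum_rankOne b s) hφn a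
    have h2 := hψ.tendsto_projection_mul (fun s => isStarProjection_sum_rankOne b s) hψn a
    refine tendsto_nhds_unique h1 ((h2.const_mul c).congr fun s => ?_)
    rw [expand, expand, Finset.mul_sum]
    exact Finset.sum_congr rfl fun i _ => (hc _ _).symm
  have hc1 : c = 1 := by
    have := hfull 1
    rw [hone] at this h0
    exact (mul_right_cancel₀ h0 ((one_mul _).trans this)).symm
  ext a
  rw [hfull, hc1, one_mul]

end Hilbert

end

section


variable {A : Type*} [CStarAlgebra A] [PartialOrder A] [StarOrderedRing A]

/-! ### Structure of atomic W*-subalgebras -/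

/-- The subalgebra is the image of a C*-algebra under an injective *-homomorphism, which is
isometric. -/
theorem IsAtomicWStarSeparable.isClosed {B : StarSubalgebra ℂ A} (hB : IsAtomicWStarSeparable B) :
    IsClosed (B : Set A) := by
  obtain ⟨ι, _, H, _, _, _, _, _, ⟨σ⟩⟩ := hB
  let _ : CStarAlgebra (lp (fun i => H i →L[ℂ] H i) ∞) :=
    { (inferInstance : NormedRing (lp (fun i => H i →L[ℂ] H i) ∞)),
      (inferInstance : StarRing (lp (fun i => H i →L[ℂ] H i) ∞)),
      (inferInstance : NormedAlgebra ℂ (lp (fun i => H i →L[ℂ] H i) ∞)),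
      (inferInstance : StarModule ℂ (lp (fun i => H i →L[ℂ] H i) ∞)),
      (inferInstance : CStarRing (lp (fun i => H i →L[ℂ] H i) ∞)),
      (inferInstance : CompleteSpace (lp (fun i => H i →L[ℂ] H i) ∞)) with }
  let f : lp (fun i => H i →L[ℂ] H i) ∞ →⋆ₙₐ[ℂ] A :=
    { toFun := fun x => (σ.symm x : A)
      map_smul' := fun c x => by simp
      map_zero' := by simp
      map_add' := fun x y => by simp
      map_mul' := fun x y => by simp
      map_star' := fun x => congrArg Subtype.val (map_star σ.symm x) }
  have hf : Function.Injective f := fun x y h => σ.symm.injective (Subtype.ext h)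
  have hiso : Isometry f := NonUnitalStarAlgHom.isometry f hf
  have : (B : Set A) = Set.range f := by
    ext x
    refine ⟨fun hx => ⟨σ ⟨x, hx⟩, by simp [f]⟩, ?_⟩
    rintro ⟨y, rfl⟩
    exact (σ.symm y).2
  rw [this]
  exact hiso.isClosedEmbedding.isClosed_range

/-- The square root is a continuous function of x and stays in the closed subalgebra. So the order
inherited from `A` is the intrinsic order of `B`, to which C*-algebraic order theory applies. -/
theorem exists_eq_star_mul_self_of_nonneg {B : StarSubalgebra ℂ A} (hB : IsClosed (B : Set A))
    {x : A} (hx : x ∈ B) (h0 : 0 ≤ x) : ∃ c ∈ B, x = star c * c := by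
  have := hB
  refine ⟨CFC.sqrt x, ?_, ?_⟩
  · rw [CFC.sqrt_eq_real_sqrt x h0]
    exact cfcₙ_mem (𝕜' := ℂ) (s := B) _ hx
  · rw [(CFC.sqrt_nonneg x).isSelfAdjoint.star_eq, CFC.sqrt_mul_sqrt_self x h0]

theorem starOrderedRing_of_isClosed {B : StarSubalgebra ℂ A} (hB : IsClosed (B : Set A)) :
    StarOrderedRing B := by
  refine StarOrderedRing.of_nonneg_iff' (fun {x y} h w => ?_) fun x => ⟨fun h => ?_, ?_⟩
  · exact add_le_add_right (α := A) h w
  · obtain ⟨c, hc, h⟩ := exists_eq_star_mul_self_of_nonneg hB x.2 h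
    exact ⟨⟨c, hc⟩, Subtype.ext h⟩
  · rintro ⟨s, rfl⟩
    exact star_mul_self_nonneg (s : A)

namespace IsCentralProjection

variable {B : StarSubalgebra ℂ A} {p q : A}

theorem mul (hp : IsCentralProjection B p) (hq : IsCentralProjection B q) :
    IsCentralProjection B (p * q) := by
  refine ⟨mul_mem hp.1 hq.1, fun x hx => ?_, hp.2.2.mul hq.2.2 (hp.2.1 q hq.1)⟩
  rw [mul_assoc, hq.2.1 x hx, ← mul_assoc, hp.2.1 x hx, mul_assoc]

theorem mul_le (hp : IsCentralProjection B p) (hq : IsCentralProjection B q) : p * q ≤ p :=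
  (hp.mul hq).2.2.le_of_mul_eq_left hp.2.2 (by
    rw [mul_assoc, ← hp.2.1 q hq.1, ← mul_assoc, hp.2.2.isIdempotentElem.eq])

end IsCentralProjection

/-- Two minimal central projections are equal if their product is not zero. -/
theorem eq_of_mul_ne_zero {B : StarSubalgebra ℂ A} {z w : A} (hz : z ∈ minimalCentralProjections B)
    (hw : w ∈ minimalCentralProjections B) (h : z * w ≠ 0) : z = w := by
  have h1 := (hz.2.2 _ (hz.1.mul hw.1) (hz.1.mul_le hw.1)).resolve_left h
  have h2 := (hw.2.2 _ (hw.1.mul hz.1) (hw.1.mul_le hz.1)).resolve_left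
    (by rwa [hw.1.2.1 z hz.1.1])
  rw [← h1, hz.1.2.1 w hw.1.1, h2]

/-- A self-adjoint idempotent in the center of `B(H)` is `0` or `1`. -/
theorem eq_zero_or_eq_one_of_central {H : Type*} [NormedAddCommGroup H] [InnerProductSpace ℂ H]
    [CompleteSpace H] {p : H →L[ℂ] H} (hp : IsStarProjection p) (h : ∀ x, p * x = x * p) :
    p = 0 ∨ p = 1 := by
  by_cases hs : Subsingleton H
  · exact .inl (ContinuousLinearMap.ext fun _ => Subsingleton.elim _ _)
  obtain ⟨v, hv⟩ := @exists_ne H (not_subsingleton_iff_nontrivial.1 hs) 0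
  have hne : inner ℂ v v ≠ (0 : ℂ) := inner_self_ne_zero.2 hv
  -- Commuting with |w⟩⟨v| for every w forces p to be a scalar.
  have h1 : ∀ w, inner ℂ v v • p w = inner ℂ (p v) v • w := fun w => by
    have := congrArg (fun T : H →L[ℂ] H => T v) (h (InnerProductSpace.rankOne ℂ w v))
    simpa [mul_rankOne, rankOne_mul, hp.isSelfAdjoint.star_eq] using this
  have h2 : p = ((inner ℂ v v : ℂ)⁻¹ * inner ℂ (p v) v) • (1 : H →L[ℂ] H) := by
    ext w
    rw [smul_apply, mul_smul, one_apply_eq_self, ← h1, smul_smul, inv_mul_cancel₀ hne, one_smul]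
  set c := ((inner ℂ v v : ℂ)⁻¹ * inner ℂ (p v) v)
  have h3 := hp.isIdempotentElem.eq
  rw [h2, smul_mul_smul_comm, one_mul] at h3
  have : Nontrivial H := not_subsingleton_iff_nontrivial.1 hs
  have h4 : c * c = c := smul_left_injective ℂ (one_ne_zero (α := H →L[ℂ] H)) h3
  rcases IsIdempotentElem.iff_eq_zero_or_one.mp h4 with h5 | h5
  · left; rw [h2, h5, zero_smul]
  · right; rw [h2, h5, one_smul]

/-- The coordinates of an atomic W*-algebra: a family of corners isomorphic to some `B(H)`, which
separate the elements. -/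
theorem IsAtomicWStarSeparable.exists_coordinates {M : Type*} [Ring M] [StarRing M] [Algebra ℂ M]
    (hM : IsAtomicWStarSeparable M) :
    ∃ (ι : Type) (H : ι → Type) (_ : ∀ i, NormedAddCommGroup (H i))
      (_ : ∀ i, InnerProductSpace ℂ (H i)) (_ : ∀ i, CompleteSpace (H i)) (_ : ∀ i, Nontrivial (H i))
      (π : ∀ i, M →⋆ₐ[ℂ] (H i →L[ℂ] H i)) (j : ∀ i, (H i →L[ℂ] H i) →⋆ₙₐ[ℂ] M),
      (∀ x, (∀ i, π i x = 0) → x = 0) ∧ (∀ i T, π i (j i T) = T) ∧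
      (∀ i x, j i (π i x) = j i 1 * x) ∧ (∀ i x, j i (π i x) = x * j i 1) := by
  classical
  obtain ⟨ι, _, H, _, _, _, _, _, ⟨σ⟩⟩ := hM
  let π : ∀ i, M →⋆ₐ[ℂ] (H i →L[ℂ] H i) := fun i =>
    { toFun := fun x => σ x i
      map_one' := by simp [lp.infty_coeFn_one]
      map_mul' := fun x y => by simp [lp.infty_coeFn_mul]
      map_zero' := by simp
      map_add' := fun x y => by simp
      commutes' := fun c => by
        rw [Algebra.algebraMap_eq_smul_one, map_smul, map_one]
        simp [lp.infty_coeFn_one, Algebra.algebraMap_eq_smul_one]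
      map_star' := fun x => by
        rw [map_star σ]
        rfl }
  let j : ∀ i, (H i →L[ℂ] H i) →⋆ₙₐ[ℂ] M := fun i =>
    { toFun := fun T => σ.symm (lp.single ∞ i T)
      map_smul' := fun c T => by simp
      map_zero' := by simp
      map_add' := fun x y => by simp
      map_mul' := fun x y => by
        rw [← map_mul]
        congr 1
        ext1
        rw [lp.infty_coeFn_mul]
        exact Pi.single_mul _ _ _
      map_star' := fun x => by
        rw [← map_star]
        congr 1
        ext1
        exact (Pi.star_single _ _).symm }
  have hext : ∀ {x y : M}, (∀ i, π i x = π i y) → x = y := fun h =>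
    σ.injective (lp.ext (funext h))
  have hπj : ∀ i T, π i (j i T) = T := fun i T => by simp [π, j]
  have hπj0 : ∀ i i' T, i ≠ i' → π i (j i' T) = 0 := fun i i' T h => by
    simp [π, j, Pi.single_eq_of_ne h]
  refine ⟨ι, H, _, _, inferInstance, inferInstance, π, j, fun x hx => hext fun i => by simp [hx],
    hπj, fun i x => hext fun i' => ?_, fun i x => hext fun i' => ?_⟩
  · rcases eq_or_ne i' i with rfl | h
    · simp [hπj]
    · simp [hπj0 _ _ _ h]
  · rcases eq_or_ne i' i with rfl | h
    · simp [hπj]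
    · simp [hπj0 _ _ _ h]

end

section


variable {A : Type*} [CStarAlgebra A] [PartialOrder A] [StarOrderedRing A]

/-! ### Minimal central projections -/

variable {B : StarSubalgebra ℂ A}

/-- A minimal central projection as an element of the subalgebra. -/
def vertexElem (z : minimalCentralProjections B) : B := ⟨z, z.2.1.1⟩

theorem vertexElem_isStarProjection (z : minimalCentralProjections B) :
    IsStarProjection (vertexElem z) :=
  ⟨Subtype.ext z.2.1.2.2.isIdempotentElem.eq, Subtype.ext z.2.1.2.2.isSelfAdjoint.star_eq⟩

theorem vertexElem_comm (z : minimalCentralProjections B) (x : B) :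
    vertexElem z * x = x * vertexElem z :=
  Subtype.ext (z.2.1.2.1 x x.2)

theorem vertexElem_mul_self (z : minimalCentralProjections B) :
    vertexElem z * vertexElem z = vertexElem z :=
  (vertexElem_isStarProjection z).isIdempotentElem.eq

theorem vertexElem_mul_vertexElem {z w : minimalCentralProjections B} (h : z ≠ w) :
    vertexElem z * vertexElem w = 0 := by
  by_contra hne
  exact h (Subtype.ext (eq_of_mul_ne_zero z.2 w.2 fun h0 => hne (Subtype.ext h0)))

theorem isStarProjection_sum_vertexElem (s : Finset (minimalCentralProjections B)) :
    IsStarProjection (∑ z ∈ s, vertexElem z) := by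
  classical
  refine ⟨?_, ?_⟩
  · rw [IsIdempotentElem, Finset.sum_mul]
    refine Finset.sum_congr rfl fun z hz => ?_
    rw [Finset.mul_sum, Finset.sum_eq_single z]
    · exact vertexElem_mul_self z
    · exact fun w _ hw => vertexElem_mul_vertexElem hw.symm
    · exact fun h => absurd hz h
  · rw [IsSelfAdjoint, star_sum]
    exact Finset.sum_congr rfl fun z _ => (vertexElem_isStarProjection z).isSelfAdjoint.star_eq

/-- A central projection below j(1) corresponds to a central projection of B(H), which is 0 or 1. -/
theorem unit_mem_minimalCentralProjections {H : Type*} [NormedAddCommGroup H]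
    [InnerProductSpace ℂ H] [CompleteSpace H] [Nontrivial H] {π : B →⋆ₐ[ℂ] (H →L[ℂ] H)}
    {j : (H →L[ℂ] H) →⋆ₙₐ[ℂ] B} (hπj : ∀ T, π (j T) = T) (hjπ : ∀ x, j (π x) = j 1 * x)
    (hjπ' : ∀ x, j (π x) = x * j 1) : (j 1 : A) ∈ minimalCentralProjections B := by
  have hproj : IsStarProjection (j 1) := (IsStarProjection.one _).map j
  have hprojA : IsStarProjection (j 1 : A) := hproj.map B.subtype
  refine ⟨⟨(j 1).2, fun x hx => ?_, hprojA⟩, fun h => ?_, fun p hp hle => ?_⟩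
  · exact congrArg Subtype.val ((hjπ ⟨x, hx⟩).symm.trans (hjπ' ⟨x, hx⟩))
  · have h1 : j 1 = 0 := Subtype.ext h
    have h2 := hπj 1
    rw [h1, map_zero] at h2
    exact one_ne_zero h2.symm
  · have hpB : IsStarProjection (⟨p, hp.1⟩ : B) :=
      ⟨Subtype.ext hp.2.2.isIdempotentElem.eq, Subtype.ext hp.2.2.isSelfAdjoint.star_eq⟩
    have he : j (π ⟨p, hp.1⟩) = ⟨p, hp.1⟩ := by
      rw [hjπ']
      exact Subtype.ext ((IsStarProjection.le_iff_mul_eq_left hp.2.2 hprojA).1 hle)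
    have hc : ∀ T, π ⟨p, hp.1⟩ * T = T * π ⟨p, hp.1⟩ := fun T => by
      rw [← hπj T, ← map_mul, ← map_mul]
      exact congrArg π (Subtype.ext (hp.2.1 _ (j T).2))
    rcases eq_zero_or_eq_one_of_central (hpB.map π) hc with h | h <;> rw [h] at he
    · left; simpa using (congrArg Subtype.val he).symm
    · right; exact (congrArg Subtype.val he).symm

/-- The summand of a minimal central projection is isomorphic to some `B(H)`. -/
theorem exists_corner_iso (hB : IsAtomicWStarSeparable B) (z : minimalCentralProjections B) :
    ∃ (H : Type) (_ : NormedAddCommGroup H) (_ : InnerProductSpace ℂ H) (_ : CompleteSpace H)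
      (π : B →⋆ₐ[ℂ] (H →L[ℂ] H)) (j : (H →L[ℂ] H) →⋆ₙₐ[ℂ] B),
      (∀ T, π (j T) = T) ∧ (∀ x, j (π x) = vertexElem z * x) := by
  obtain ⟨ι, H, _, _, _, _, π, j, hsep, hπj, hjπ, hjπ'⟩ := hB.exists_coordinates
  have hmem := fun i => unit_mem_minimalCentralProjections (hπj i) (hjπ i) (hjπ' i)
  -- The coordinates separate points, so z meets the unit of some block; two minimal central
  -- projections that meet are equal.
  obtain ⟨i, hi⟩ : ∃ i, (z : A) * j i 1 ≠ 0 := by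
    by_contra! h
    refine z.2.2.1 (congrArg Subtype.val (hsep (vertexElem z) fun i => ?_))
    have h1 : j i (π i (vertexElem z)) = 0 := (hjπ' i _).trans (Subtype.ext (h i))
    rw [← hπj i (π i (vertexElem z)), h1, map_zero]
  have hz : vertexElem z = j i 1 := Subtype.ext (eq_of_mul_ne_zero z.2 (hmem i) hi)
  exact ⟨H i, _, _, inferInstance, π i, j i, hπj i, fun x => hz ▸ hjπ i x⟩

theorem eq_zero_of_vertexElem_mul_eq_zero (hB : IsAtomicWStarSeparable B) {x : B}
    (h : ∀ z : minimalCentralProjections B, vertexElem z * x = 0) : x = 0 := by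
  obtain ⟨ι, H, _, _, _, _, π, j, hsep, hπj, hjπ, hjπ'⟩ := hB.exists_coordinates
  have hmem := fun i => unit_mem_minimalCentralProjections (hπj i) (hjπ i) (hjπ' i)
  refine hsep x fun i => ?_
  rw [← hπj i (π i x), hjπ i]
  have := h ⟨j i 1, hmem i⟩
  rw [← map_zero (π i)]
  exact congrArg _ this

/-- Let x be an upper bound and n the negative part of y = x - 1. Each z ≤ x makes z y nonnegative
after compression, whereas n y n = -n³; so z n³ = 0 for every z, hence n = 0 and x ≥ 1. -/
theorem isLUB_sum_vertexElem (hB : IsAtomicWStarSeparable B) :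
    IsLUB (Set.range fun s : Finset (minimalCentralProjections B) => ∑ z ∈ s, vertexElem z) 1 := by
  have := hB.isClosed
  have := starOrderedRing_of_isClosed hB.isClosed
  refine ⟨?_, fun x hx => ?_⟩
  · rintro _ ⟨s, rfl⟩
    exact (isStarProjection_sum_vertexElem s).le_one
  have hx0 : 0 ≤ x := hx ⟨∅, by simp⟩
  have hxz : ∀ z : minimalCentralProjections B, 0 ≤ x - vertexElem z := fun z =>
    sub_nonneg.2 (hx ⟨{z}, by simp⟩)
  set y := x - 1 with hy
  have hysa : IsSelfAdjoint y := hx0.isSelfAdjoint.sub (IsSelfAdjoint.one B)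
  set n := y⁻ with hn
  have hn0 : 0 ≤ n := CFC.negPart_nonneg y
  have hnyn : n * y * n = -(n * n * n) := by
    conv_lhs => rw [← CFC.posPart_sub_negPart y hysa]
    rw [mul_sub, CFC.negPart_mul_posPart, zero_sub, neg_mul]
  -- `h1` writes z n³ as a conjugate of n ≥ 0, and `h2` writes -z n³ as a conjugate of x - z ≥ 0.
  have hcube : n * n * n = 0 := by
    refine eq_zero_of_vertexElem_mul_eq_zero hB fun z => ?_
    have hzsa := (vertexElem_isStarProjection z).isSelfAdjoint
    have hzz := vertexElem_mul_self z
    have hnsa := hn0.isSelfAdjoint.star_eq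
    have h1 : 0 ≤ vertexElem z * (n * n * n) := by
      have := star_left_conjugate_nonneg hn0 (n * vertexElem z)
      rwa [star_mul, hnsa, hzsa.star_eq, ← vertexElem_comm z n, ← mul_assoc,
        mul_assoc (vertexElem z * n) n, ← vertexElem_comm z n, mul_assoc, mul_assoc,
        mul_assoc (vertexElem z), ← mul_assoc n, ← vertexElem_comm z n, ← mul_assoc,
        ← mul_assoc, ← mul_assoc, hzz, mul_assoc, mul_assoc, ← mul_assoc n] at this
    have h2 : 0 ≤ -(vertexElem z * (n * n * n)) := by
      have := star_left_conjugate_nonneg (hxz z) (vertexElem z * n)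
      have e : vertexElem z * (x - vertexElem z) * vertexElem z = vertexElem z * y := by
        rw [← vertexElem_comm, ← mul_assoc, hzz, hy, mul_sub, mul_sub, mul_one, hzz]
      rwa [star_mul, hnsa, hzsa.star_eq, ← mul_assoc, mul_assoc n, mul_assoc n, e, ← mul_assoc,
        ← vertexElem_comm z n, mul_assoc, mul_assoc, ← mul_assoc n, hnyn, mul_neg] at this
    exact le_antisymm (neg_nonneg.1 h2) h1
  have hnsa := hn0.isSelfAdjoint.star_eq
  have hsq : n * n = 0 := by
    have : star (n * n) * (n * n) = 0 := by
      rw [star_mul, hnsa, ← mul_assoc, hcube, zero_mul]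
    exact CStarRing.star_mul_self_eq_zero_iff _ |>.1 this
  have hzero : n = 0 := CStarRing.star_mul_self_eq_zero_iff _ |>.1 (by rwa [hnsa])
  have : 0 ≤ y := (CFC.negPart_eq_zero_iff y hysa).1 hzero
  exact sub_nonneg.1 this

end

section


variable {A : Type*} [CStarAlgebra A] [PartialOrder A] [StarOrderedRing A]

/-! ### The flow -/

namespace AtomicSystem

variable (S : AtomicSystem A) (n : ℕ)

instance isClosed_alg : IsClosed (S.alg n : Set A) := (S.atomic n).isClosed

instance starOrderedRing_alg : StarOrderedRing (S.alg n) :=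
  starOrderedRing_of_isClosed (S.isClosed_alg n)

end AtomicSystem

namespace InductiveFlow

variable {S : AtomicSystem A} (α : InductiveFlow S)

theorem at'_add (t : ℝ) (x y : A) : α.at' t (x + y) = α.at' t x + α.at' t y := map_add _ _ _

theorem at'_mul (t : ℝ) (x y : A) : α.at' t (x * y) = α.at' t x * α.at' t y := map_mul _ _ _

theorem at'_map_zero (t : ℝ) : α.at' t 0 = 0 := map_zero _

theorem at'_smul (t : ℝ) (c : ℂ) (x : A) : α.at' t (c • x) = c • α.at' t x := map_smul _ _ _

theorem at'_star (t : ℝ) (x : A) : α.at' t (star x) = star (α.at' t x) := map_star _ _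

theorem at'_at' (s t : ℝ) (x : A) : α.at' s (α.at' t x) = α.at' (s + t) x := by
  simp [at', ofAdd_add, map_mul]

theorem at'_zero (x : A) : α.at' 0 x = x := by
  simp [at']

theorem at'_neg_at' (t : ℝ) (x : A) : α.at' (-t) (α.at' t x) = x := by
  rw [at'_at', neg_add_cancel, at'_zero]

theorem at'_at'_neg (t : ℝ) (x : A) : α.at' t (α.at' (-t) x) = x := by
  rw [at'_at', add_neg_cancel, at'_zero]

theorem norm_at' (t : ℝ) (x : A) : ‖α.at' t x‖ = ‖x‖ :=
  StarAlgEquiv.norm_map (α.aut (Multiplicative.ofAdd t)) x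

theorem at'_mono (t : ℝ) : Monotone (α.at' t) :=
  OrderHomClass.mono (α.aut (Multiplicative.ofAdd t))

theorem isStarProjection_at' (t : ℝ) {p : A} (hp : IsStarProjection p) :
    IsStarProjection (α.at' t p) :=
  ⟨by rw [IsIdempotentElem, ← at'_mul, hp.isIdempotentElem.eq],
    by rw [IsSelfAdjoint, ← at'_star, hp.isSelfAdjoint.star_eq]⟩

theorem isCentralProjection_at' (t : ℝ) {n : ℕ} {p : A} (hp : IsCentralProjection (S.alg n) p) :
    IsCentralProjection (S.alg n) (α.at' t p) := by
  refine ⟨α.at'_mem t n hp.1, fun x hx => ?_, α.isStarProjection_at' t hp.2.2⟩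
  rw [← α.at'_at'_neg t x, ← at'_mul, ← at'_mul, hp.2.1 _ (α.at'_mem (-t) n hx)]

theorem at'_mem_minimalCentralProjections (t : ℝ) {n : ℕ} {z : A}
    (hz : z ∈ minimalCentralProjections (S.alg n)) :
    α.at' t z ∈ minimalCentralProjections (S.alg n) := by
  refine ⟨α.isCentralProjection_at' t hz.1, fun h => hz.2.1 ?_, fun p hp hle => ?_⟩
  · rw [← α.at'_neg_at' t z, h, at'_map_zero]
  · have h1 := α.at'_mono (-t) hle
    rw [at'_neg_at'] at h1
    rcases hz.2.2 _ (α.isCentralProjection_at' (-t) hp) h1 with h | h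
    · left
      rw [← α.at'_at'_neg t p, h, at'_map_zero]
    · right
      rw [← h, at'_at'_neg]

/-- The restriction of the flow to `A_n`. -/
def level (n : ℕ) (t : ℝ) (x : S.alg n) : S.alg n := ⟨α.at' t x, α.at'_mem t n x.2⟩

end InductiveFlow

/-! ### Normality of inclusions and compressions -/

theorem vertexElem_mul_nonneg {S : AtomicSystem A} {n : ℕ} (z : Vertex S n) {x : S.alg n}
    (hx : 0 ≤ x) : 0 ≤ vertexElem z * x := by
  have := star_left_conjugate_nonneg hx (vertexElem z)
  rwa [(vertexElem_isStarProjection z).isSelfAdjoint.star_eq, mul_assoc, ← vertexElem_comm z x,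
    ← mul_assoc, vertexElem_mul_self] at this

theorem vertexElem_mul_le {S : AtomicSystem A} {n : ℕ} (z : Vertex S n) {x : S.alg n}
    (hx : 0 ≤ x) : vertexElem z * x ≤ x := by
  have hp := (vertexElem_isStarProjection z).one_sub
  have := star_left_conjugate_nonneg hx (1 - vertexElem z)
  rw [hp.isSelfAdjoint.star_eq, mul_assoc, mul_sub, mul_one, ← vertexElem_comm z x, ← one_sub_mul,
    ← mul_assoc, hp.isIdempotentElem.eq, one_sub_mul] at this
  exact sub_nonneg.1 this

theorem vertexElem_mul_mono {S : AtomicSystem A} {n : ℕ} (z : Vertex S n) :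
    Monotone fun x : S.alg n => vertexElem z * x := fun x y h => by
  have := vertexElem_mul_nonneg z (sub_nonneg.2 h)
  rw [mul_sub] at this
  exact sub_nonneg.1 this

/-- Adding the complementary part (1 - z) x turns a bound y on the compressed set into a bound on d
itself. -/
theorem le_of_vertexElem_mul_le {S : AtomicSystem A} {n : ℕ} {z : Vertex S n} {d : Set (S.alg n)}
    {x y : S.alg n} (hx : IsLUB d x) (h : ∀ w ∈ d, vertexElem z * w ≤ y) :
    vertexElem z * x ≤ y := by
  have h1 : x ≤ y + (x - vertexElem z * x) := by
    refine hx.2 fun w hw => ?_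
    have h2 := vertexElem_mul_le z (sub_nonneg.2 (hx.1 hw))
    rw [mul_sub] at h2
    calc w = vertexElem z * w + (w - vertexElem z * w) := by abel
      _ ≤ y + (x - vertexElem z * x) := add_le_add (h w hw) (by
        rw [sub_le_sub_iff] at h2 ⊢
        rwa [add_comm w])
  rwa [← add_sub_assoc, le_sub_iff_add_le, add_comm y, add_le_add_iff_left] at h1

theorem isNormalMap_vertexElem_mul {S : AtomicSystem A} {n : ℕ} (z : Vertex S n) :
    IsNormalMap fun x : S.alg n => vertexElem z * x := by
  intro d x hd hne hdir hx
  refine ⟨?_, fun y hy => le_of_vertexElem_mul_le hx fun w hw => hy ⟨w, hw, rfl⟩⟩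
  rintro _ ⟨w, hw, rfl⟩
  exact vertexElem_mul_mono z (hx.1 hw)

/-- The compression `A_n → z A_n`. -/
def compression {S : AtomicSystem A} {n : ℕ} (z : Vertex S n) :
    S.alg n →ₗ[ℂ] summand (S.alg n) z where
  toFun x := summandMk (S.alg n) z x x.2
  map_add' _ _ := Subtype.ext (mul_add _ _ _)
  map_smul' _ _ := Subtype.ext (mul_smul_comm _ _ _)

/-- The inclusion `z A_n → A_n`. -/
def summandIncl {S : AtomicSystem A} {n : ℕ} (z : Vertex S n) :
    summand (S.alg n) z →ₗ[ℂ] S.alg n where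
  toFun x := ⟨x, x.2.1⟩
  map_add' _ _ := rfl
  map_smul' _ _ := rfl

theorem vertexElem_mul_summandIncl {S : AtomicSystem A} {n : ℕ} (z : Vertex S n)
    (x : summand (S.alg n) z) : vertexElem z * summandIncl z x = summandIncl z x :=
  Subtype.ext x.2.2

theorem isNormalMap_compression {S : AtomicSystem A} {n : ℕ} (z : Vertex S n) :
    IsNormalMap (compression z) := by
  intro d x hd hne hdir hx
  refine ⟨?_, fun y hy => ?_⟩
  · rintro _ ⟨w, hw, rfl⟩
    exact vertexElem_mul_mono z (hx.1 hw)
  · exact le_of_vertexElem_mul_le (y := summandIncl z y) hx fun w hw => hy ⟨w, hw, rfl⟩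

/-- An upper bound y taken in `A_n` may be replaced by z y ≤ y, which lies in the summand. -/
theorem isNormalMap_summandIncl {S : AtomicSystem A} {n : ℕ} (z : Vertex S n) :
    IsNormalMap (summandIncl z) := by
  intro d x hd hne hdir hx
  refine ⟨?_, fun y hy => ?_⟩
  · rintro _ ⟨w, hw, rfl⟩
    exact hx.1 hw
  · have hy0 : 0 ≤ y := by
      obtain ⟨w, hw⟩ := hne
      exact le_trans (hd w hw : (0 : S.alg n) ≤ summandIncl z w) (hy ⟨w, hw, rfl⟩)
    have h1 : x ≤ compression z y := by
      refine hx.2 fun w hw => ?_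
      have := vertexElem_mul_mono z (hy ⟨w, hw, rfl⟩)
      simp only [vertexElem_mul_summandIncl] at this
      exact this
    exact le_trans (h1 : summandIncl z x ≤ vertexElem z * y) (vertexElem_mul_le z hy0)

end

section


variable {A : Type*} [CStarAlgebra A] [PartialOrder A] [StarOrderedRing A]
  {S : AtomicSystem A} (α : InductiveFlow S) (β : ℝ) {n : ℕ}

/-! ### Normal KMS functionals on `A_n` -/

/-- A positive normal KMS functional on `A_n`, not necessarily normalized. -/
structure IsKMSFunctional (f : S.alg n →ₗ[ℂ] ℂ) : Prop where
  pos : IsPositiveFunctional f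
  normal : IsNormalMap f
  kms : IsKMS (α.level n) β f

variable {α β} {f g : S.alg n →ₗ[ℂ] ℂ}

theorem isPositiveFunctional_comp_vertexElem_mul (hf : IsPositiveFunctional f) (z : Vertex S n) :
    IsPositiveFunctional (f ∘ₗ LinearMap.mulLeft ℂ (vertexElem z)) := fun x =>
  hf.map_nonneg (vertexElem_mul_nonneg z (star_mul_self_nonneg x))

/-- The flow fixes the minimal central projections in the support of a normal positive
functional. -/
theorem InductiveFlow.at'_vertex (α : InductiveFlow S) (hf : IsPositiveFunctional f)
    (hn : IsNormalMap f) {z : Vertex S n} (hz : f (vertexElem z) ≠ 0) (t : ℝ) :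
    α.at' t z = z := by
  have hg := isPositiveFunctional_comp_vertexElem_mul hf z
  let g : S.alg n →L[ℂ] ℂ := LinearMap.mkContinuous _ _ hg.norm_le
  have hgn : IsNormalMap g := hn.comp (isNormalMap_vertexElem_mul z) (vertexElem_mul_mono z)
    fun x hx => vertexElem_mul_nonneg z hx
  have hgz : g (vertexElem z) = f (vertexElem z) := by
    change f (vertexElem z * vertexElem z) = _
    rw [vertexElem_mul_self]
  have hpos : 0 < ‖f (vertexElem z)‖ := norm_pos_iff.2 hz
  have hev := α.continuous_on_predual n g (Submodule.subset_span ⟨hg, hgn⟩) _ (half_pos hpos)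
  have hlocal : ∀ᶠ t in 𝓝 (0 : ℝ), α.at' t z = z := by
    filter_upwards [hev] with t ht
    -- A moved vertex is orthogonal to z, so the functional f(z ·) would drop from f(z) to 0, which
    -- continuity excludes for small t.
    by_contra hne
    have h1 := ht (vertexElem z)
    have h2 : g (α.level n t (vertexElem z)) = 0 := by
      have : vertexElem z * α.level n t (vertexElem z) = 0 :=
        vertexElem_mul_vertexElem (w := ⟨_, α.at'_mem_minimalCentralProjections t z.2⟩)
          fun h => hne (congrArg Subtype.val h).symm
      change f (vertexElem z * α.level n t (vertexElem z)) = 0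
      rw [this, map_zero]
    have h3 : ‖g (α.level n t (vertexElem z)) - g (vertexElem z)‖ ≤
      ‖f (vertexElem z)‖ / 2 * ‖vertexElem z‖ := h1
    rw [h2, zero_sub, norm_neg, hgz] at h3
    have h4 : ‖vertexElem z‖ ≤ 1 := (vertexElem_isStarProjection z).norm_le
    nlinarith
  obtain ⟨δ, hδ, hball⟩ := Metric.eventually_nhds_iff.1 hlocal
  -- Group law: a general t is N small steps t / N, each of which fixes z.
  obtain ⟨N, hN⟩ := exists_nat_gt (|t| / δ)
  have hN0 : (0 : ℝ) < N := lt_of_le_of_lt (by positivity) hN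
  have hstep : α.at' (t / N) z = z := hball (by
    rw [Real.dist_eq, sub_zero, abs_div, abs_of_pos hN0, div_lt_iff₀ hN0]
    rwa [div_lt_iff₀ hδ, mul_comm] at hN)
  have hiter : ∀ k : ℕ, α.at' (k * (t / N)) z = z := by
    intro k
    induction k with
    | zero => simpa using α.at'_zero z
    | succ k ih => rw [Nat.cast_succ, add_one_mul, ← α.at'_at', hstep, ih]
  have := hiter N
  rwa [mul_div_cancel₀ _ hN0.ne'] at this

/-- The inclusion of a corner `B(H)` into `A_n` is normal. -/
theorem isLUB_corner {H : Type*} [NormedAddCommGroup H] [InnerProductSpace ℂ H] [CompleteSpace H]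
    {z : Vertex S n} {π : S.alg n →⋆ₐ[ℂ] (H →L[ℂ] H)} {j : (H →L[ℂ] H) →⋆ₙₐ[ℂ] S.alg n}
    (hjπ : ∀ x, j (π x) = vertexElem z * x) {d : Set (H →L[ℂ] H)} (hne : d.Nonempty)
    (hd : ∀ x ∈ d, 0 ≤ x) (hπj : ∀ T, π (j T) = T) {x : H →L[ℂ] H} (hx : IsLUB d x) :
    IsLUB (j '' d) (j x) := by
  have hj : Monotone j := OrderHomClass.mono j
  have hπ : Monotone π := OrderHomClass.mono π
  refine ⟨?_, fun y hy => ?_⟩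
  · rintro _ ⟨T, hT, rfl⟩
    exact hj (hx.1 hT)
  · have hy0 : 0 ≤ y := by
      obtain ⟨T, hT⟩ := hne
      have := hj (hd T hT)
      rw [map_zero] at this
      exact this.trans (hy ⟨T, hT, rfl⟩)
    have h1 : x ≤ π y := hx.2 fun T hT => by
      have := hπ (hy ⟨T, hT, rfl⟩)
      rwa [hπj] at this
    have h2 := hj h1
    rw [hjπ] at h2
    exact h2.trans (vertexElem_mul_le z hy0)

namespace IsKMSFunctional

theorem level_vertexElem (hf : IsKMSFunctional α β f) {z : Vertex S n} (hz : f (vertexElem z) ≠ 0)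
    (t : ℝ) : α.level n t (vertexElem z) = vertexElem z :=
  Subtype.ext (α.at'_vertex hf.pos hf.normal hz t)

theorem const_mul (hf : IsKMSFunctional α β f) {c : ℂ} (hc : 0 ≤ c) :
    IsKMSFunctional α β (c • f) where
  pos x := mul_nonneg hc (hf.pos x)
  normal := hf.normal.const_mul hc
  kms a b := HasStripExtension.const_mul c (hf.kms a b)

protected theorem zero : IsKMSFunctional α β (0 : S.alg n →ₗ[ℂ] ℂ) where
  pos _ := le_rfl
  normal := IsNormalMap.const
  kms _ _ := HasStripExtension.const 0

theorem map_vertexElem_mul_eq_zero (hf : IsKMSFunctional α β f) {z : Vertex S n}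
    (hz : f (vertexElem z) = 0) (x : S.alg n) : f (vertexElem z * x) = 0 :=
  hf.pos.map_projection_mul_eq_zero (vertexElem_isStarProjection z) hz x

/-- Normal KMS functionals that agree on a minimal central projection agree on its summand. -/
theorem eq_on_summand (hf : IsKMSFunctional α β f) (hg : IsKMSFunctional α β g) {z : Vertex S n}
    (h : f (vertexElem z) = g (vertexElem z)) (x : S.alg n) :
    f (vertexElem z * x) = g (vertexElem z * x) := by
  by_cases hz : f (vertexElem z) = 0
  · rw [hf.map_vertexElem_mul_eq_zero hz, hg.map_vertexElem_mul_eq_zero (h ▸ hz)]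
  have hfix := hf.level_vertexElem hz
  obtain ⟨H, _, _, _, π, j, hπj, hjπ⟩ := exists_corner_iso (S.atomic n) z
  have hj1 : j 1 = vertexElem z := by rw [← map_one π, hjπ, mul_one]
  have hjT : ∀ T, vertexElem z * j T = j T := fun T => by rw [← hjπ, hπj]
  have hlevel_mul : ∀ t (a b : S.alg n), α.level n t (a * b) = α.level n t a * α.level n t b :=
    fun t a b => Subtype.ext (α.at'_mul t a b)
  -- The flow transported to B(H). It is a flow of automorphisms because α fixes z and so preserves
  -- the corner.
  let γ : ℝ → (H →L[ℂ] H) → (H →L[ℂ] H) := fun t T => π (α.level n t (j T))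
  have hjγ : ∀ t T, j (γ t T) = α.level n t (j T) := fun t T => by
    change j (π _) = _
    rw [hjπ]
    conv_lhs => rw [← hfix t, ← hlevel_mul, hjT]
  have hγγ : ∀ s t T, γ s (γ t T) = γ (s + t) T := fun s t T => by
    change π (α.level n s (j (γ t T))) = _
    rw [hjγ]
    exact congrArg π (Subtype.ext (α.at'_at' s t _))
  have hγ0 : ∀ T, γ 0 T = T := fun T => by
    have : α.level n 0 (j T) = j T := Subtype.ext (α.at'_zero _)
    change π (α.level n 0 (j T)) = T
    rw [this, hπj]
  have hbij : ∀ t, Function.Bijective (γ t) := fun t =>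
    Function.bijective_iff_has_inverse.2 ⟨γ (-t), fun T => by rw [hγγ, neg_add_cancel, hγ0],
      fun T => by rw [hγγ, add_neg_cancel, hγ0]⟩
  obtain ⟨w, b, -⟩ := exists_hilbertBasis ℂ H
  have hcond : ∀ {χ : S.alg n →ₗ[ℂ] ℂ}, IsKMSFunctional α β χ →
      IsPositiveFunctional (χ ∘ₗ (j : (H →L[ℂ] H) →ₗ[ℂ] S.alg n)) ∧
      IsKMS γ β (χ ∘ₗ (j : (H →L[ℂ] H) →ₗ[ℂ] S.alg n)) ∧
      Filter.Tendsto (fun s : Finset w => (χ ∘ₗ (j : (H →L[ℂ] H) →ₗ[ℂ] S.alg n))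
        (∑ i ∈ s, InnerProductSpace.rankOne ℂ (b i) (b i))) Filter.atTop
        (𝓝 ((χ ∘ₗ (j : (H →L[ℂ] H) →ₗ[ℂ] S.alg n)) 1)) := by
    intro χ hχ
    refine ⟨fun T => ?_, fun T T' => ?_, ?_⟩
    · have := hχ.pos (j T)
      rwa [← map_star, ← map_mul] at this
    · have h1 : HasStripExtension β _ _ := hχ.kms (j T) (j T')
      simp only [← hjγ, ← map_mul] at h1
      exact h1
    · have hnn : ∀ s : Finset w,
          0 ≤ (∑ i ∈ s, InnerProductSpace.rankOne ℂ (b i) (b i) : H →L[ℂ] H) := fun s =>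
        (isStarProjection_sum_rankOne b s).nonneg
      have hlub := isLUB_corner (z := z) hjπ (Set.range_nonempty _)
        (by rintro _ ⟨s, rfl⟩; exact hnn s) hπj (isLUB_sum_rankOne b)
      rw [← Set.range_comp] at hlub
      refine hχ.normal.tendsto (fun s s' hss => ?_) (fun s => ?_) hlub
      · refine OrderHomClass.mono j (Finset.sum_le_sum_of_subset_of_nonneg hss fun i _ _ => ?_)
        simpa using hnn {i}
      · have : Monotone j := OrderHomClass.mono j
        have := this (hnn s)
        rwa [map_zero] at this
  obtain ⟨f1, f2, f3⟩ := hcond hf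
  obtain ⟨g1, g2, g3⟩ := hcond hg
  have := eq_of_isKMS hγ0 (fun t T T' => ?_) (fun t T T' => ?_) (fun t T => ?_) (fun t c T => ?_)
    hbij f1 g1 f2 g2 b f3 g3 (by simpa [hj1] using h)
  · have := LinearMap.congr_fun this (π x)
    simpa [hjπ] using this
  · change π _ = π _ + π _
    rw [← map_add, map_add j]
    exact congrArg π (Subtype.ext (α.at'_add t _ _))
  · change π _ = π _ * π _
    rw [← map_mul, map_mul j, hlevel_mul]
  · change π _ = star (π _)
    rw [← map_star π, map_star j]
    exact congrArg π (Subtype.ext (α.at'_star t _))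
  · change π _ = c • π _
    rw [← map_smul, map_smul j]
    exact congrArg π (Subtype.ext (α.at'_smul t _ _))

end IsKMSFunctional

end

section


variable {A : Type*} [CStarAlgebra A] [PartialOrder A] [StarOrderedRing A]
  {S : AtomicSystem A} {α : InductiveFlow S} {β : ℝ} {n : ℕ}

/-! ### Local Gibbs states -/

/-- The compression is a normal *-homomorphism. It intertwines the flows because α fixes z, which
the normal functional τ(z ·) itself forces, being nonzero at z. -/
theorem isKMSFunctional_of_mem_localKMS {z : Vertex S n} {τ : summand (S.alg n) z →L[ℂ] ℂ}
    (hτ : τ ∈ localKMS α β z) :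
    IsKMSFunctional α β ((τ : summand (S.alg n) z →ₗ[ℂ] ℂ) ∘ₗ compression z) := by
  obtain ⟨⟨hpos, hone⟩, hnormal, hkms⟩ := hτ
  have hmul : ∀ x y, compression z (x * y) = compression z x * compression z y := fun x y =>
    Subtype.ext (by
      change (vertexElem z * (x * y) : S.alg n).1 = (vertexElem z * x * (vertexElem z * y) : S.alg n).1
      rw [mul_assoc _ x, ← mul_assoc x, ← vertexElem_comm z x, mul_assoc _ x,
        ← mul_assoc (vertexElem z) (vertexElem z), vertexElem_mul_self])
  have hstar : ∀ x, compression z (star x) = star (compression z x) := fun x =>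
    Subtype.ext (by
      change (vertexElem z * star x : S.alg n).1 = (star (vertexElem z * x) : S.alg n).1
      rw [star_mul, (vertexElem_isStarProjection z).isSelfAdjoint.star_eq, vertexElem_comm])
  have h1 : IsPositiveFunctional ((τ : summand (S.alg n) z →ₗ[ℂ] ℂ) ∘ₗ compression z) := fun x => by
    have := hpos (compression z x)
    rwa [← hstar, ← hmul] at this
  have h2 : IsNormalMap ((τ : summand (S.alg n) z →ₗ[ℂ] ℂ) ∘ₗ compression z) :=
    IsNormalMap.comp (g := τ) (f := compression z) hnormal (isNormalMap_compression z) (vertexElem_mul_mono z)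
      fun x hx => vertexElem_mul_nonneg z hx
  have hz : ((τ : summand (S.alg n) z →ₗ[ℂ] ℂ) ∘ₗ compression z) (vertexElem z) ≠ 0 := by
    have : compression z (vertexElem z) = summandUnit (S.alg n) z :=
      Subtype.ext z.2.1.2.2.isIdempotentElem.eq
    change τ _ ≠ 0
    rw [this, hone]
    exact one_ne_zero
  refine ⟨h1, h2, fun a b => ?_⟩
  have h3 : HasStripExtension β _ _ := hkms (compression z a) (compression z b)
  have e : ∀ t, localFlow α z t (compression z a) = compression z (α.level n t a) := fun t =>
    Subtype.ext (by
      change (z : A) * α.at' t (z * a) = z * α.at' t a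
      rw [α.at'_mul, α.at'_vertex h1 h2 hz, ← mul_assoc, z.2.1.2.2.isIdempotentElem.eq])
  simp only [e, ← hmul] at h3
  exact h3

/-- The normalized restriction of a normal KMS functional to a summand on which it does not vanish
is a local Gibbs state. -/
theorem IsKMSFunctional.localKMS_nonempty {f : S.alg n →ₗ[ℂ] ℂ} (hf : IsKMSFunctional α β f)
    {z : Vertex S n} (hz : f (vertexElem z) ≠ 0) : (localKMS α β z).Nonempty := by
  set c := (f (vertexElem z))⁻¹ with hc
  have hc0 : 0 ≤ c := by
    have h := (hf.pos.map_projection_nonneg (vertexElem_isStarProjection z)).lt_of_ne' hz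
    exact (inv_pos_of_pos h).le
  have hg := hf.const_mul hc0
  have hbound : ∀ x : summand (S.alg n) z, ‖((c • f) ∘ₗ summandIncl z) x‖ ≤
      ((c • f) 1).re * ‖x‖ := fun x => hg.pos.norm_le (summandIncl z x)
  refine ⟨LinearMap.mkContinuous _ _ hbound, ⟨fun x => hg.pos (summandIncl z x), ?_⟩, ?_, ?_⟩
  · exact inv_mul_cancel₀ hz
  · exact hg.normal.comp (isNormalMap_summandIncl z) (fun _ _ h => h) fun _ h => h
  · intro a b
    have h3 : HasStripExtension β _ _ := hg.kms (summandIncl z a) (summandIncl z b)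
    have e : ∀ t, α.level n t (summandIncl z a) = summandIncl z (localFlow α z t a) := fun t =>
      Subtype.ext (by
        change α.at' t a = z * α.at' t a
        conv_lhs => rw [← a.2.2, α.at'_mul, α.at'_vertex hf.pos hf.normal hz])
    simp only [e] at h3
    exact h3

variable (α β) in
/-- The local Gibbs state at `z`, extended to `A_n` by compression. -/
def gibbsFunctional (z : Vertex S n) : S.alg n →ₗ[ℂ] ℂ :=
  (gibbs α β z : summand (S.alg n) z →ₗ[ℂ] ℂ) ∘ₗ compression z

/-- The default value 0 is also a KMS functional, so later arguments need not ask whether a Gibbs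
state exists. -/
theorem isKMSFunctional_gibbsFunctional (z : Vertex S n) :
    IsKMSFunctional α β (gibbsFunctional α β z) := by
  by_cases h : (localKMS α β z).Nonempty
  · rw [gibbsFunctional, gibbs, dif_pos h]
    exact isKMSFunctional_of_mem_localKMS h.some_mem
  · rw [gibbsFunctional, gibbs, dif_neg h]
    exact IsKMSFunctional.zero

theorem gibbsFunctional_vertexElem_mul (z : Vertex S n) (x : S.alg n) :
    gibbsFunctional α β z (vertexElem z * x) = gibbsFunctional α β z x := by
  have : compression z (vertexElem z * x) = compression z x := Subtype.ext (by
    change (vertexElem z * (vertexElem z * x) : S.alg n).1 = (vertexElem z * x : S.alg n).1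
    rw [← mul_assoc, vertexElem_mul_self])
  exact congrArg (gibbs α β z) this

theorem gibbsFunctional_one (z : Vertex S n) :
    gibbsFunctional α β z 1 = gibbsFunctional α β z (vertexElem z) := by
  rw [← gibbsFunctional_vertexElem_mul z 1, mul_one]

theorem gibbsFunctional_one_of_nonempty {z : Vertex S n} (h : (localKMS α β z).Nonempty) :
    gibbsFunctional α β z 1 = 1 := by
  have h1 : compression z 1 = summandUnit (S.alg n) z := Subtype.ext (mul_one (z : A))
  change gibbs α β z (compression z 1) = 1
  rw [h1, gibbs, dif_pos h]
  exact h.some_mem.1.2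

theorem gibbsFunctional_one_re_le (z : Vertex S n) : (gibbsFunctional α β z 1).re ≤ 1 := by
  by_cases h : (localKMS α β z).Nonempty
  · rw [gibbsFunctional_one_of_nonempty h, Complex.one_re]
  · rw [gibbsFunctional, gibbs, dif_neg h]
    simp

theorem norm_gibbsFunctional_le (z : Vertex S n) (x : S.alg n) :
    ‖gibbsFunctional α β z x‖ ≤ ‖x‖ :=
  ((isKMSFunctional_gibbsFunctional z).pos.norm_le x).trans
    (mul_le_of_le_one_left (norm_nonneg x) (gibbsFunctional_one_re_le z))

namespace IsKMSFunctional

variable {f : S.alg n →ₗ[ℂ] ℂ}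

/-- If f(z) = 0, Cauchy–Schwarz kills the whole summand. Otherwise a Gibbs state exists, and f and
f(z) τ_z have the same mass at z, so uniqueness applies. -/
theorem map_vertexElem_mul (hf : IsKMSFunctional α β f) (z : Vertex S n) (x : S.alg n) :
    f (vertexElem z * x) = f (vertexElem z) * gibbsFunctional α β z x := by
  by_cases hz : f (vertexElem z) = 0
  · rw [hf.map_vertexElem_mul_eq_zero hz, hz, zero_mul]
  have hne := hf.localKMS_nonempty hz
  have hg := (isKMSFunctional_gibbsFunctional (α := α) (β := β) z).const_mul
    (hf.pos.map_projection_nonneg (vertexElem_isStarProjection z))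
  have h1 := gibbsFunctional_one_of_nonempty hne
  rw [gibbsFunctional_one] at h1
  rw [hf.eq_on_summand hg (by simp [h1]) x]
  simp [gibbsFunctional_vertexElem_mul]

/-- A normal KMS functional is the superposition of the local Gibbs states. -/
theorem hasSum_gibbsFunctional (hf : IsKMSFunctional α β f) (x : S.alg n) :
    HasSum (fun z => f (vertexElem z) * gibbsFunctional α β z x) (f x) := by
  have hmono : Monotone fun s : Finset (Vertex S n) => ∑ z ∈ s, vertexElem z := fun s s' h =>
    Finset.sum_le_sum_of_subset_of_nonneg h fun z _ _ => (vertexElem_isStarProjection z).nonneg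
  have h1 := hf.normal.tendsto hmono (fun s => (isStarProjection_sum_vertexElem s).nonneg)
    (isLUB_sum_vertexElem (S.atomic n))
  refine (hf.pos.tendsto_projection_mul isStarProjection_sum_vertexElem h1 x).congr fun s => ?_
  rw [Finset.sum_mul, map_sum]
  exact Finset.sum_congr rfl fun z _ => hf.map_vertexElem_mul z x

/-- A normal KMS functional vanishes on the summands without local Gibbs state. -/
theorem map_vertexElem_mul_gibbsFunctional_one (hf : IsKMSFunctional α β f) (z : Vertex S n) :
    f (vertexElem z) * gibbsFunctional α β z 1 = f (vertexElem z) := by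
  rw [← hf.map_vertexElem_mul, mul_one]

/-- Here normality of the inclusions enters: a Gibbs state of level n + 1 restricts to a
superposition of Gibbs states of level n. -/
theorem comp_inclusion {f : S.alg (n + 1) →ₗ[ℂ] ℂ} (hf : IsKMSFunctional α β f) :
    IsKMSFunctional α β
      (f ∘ₗ ((StarSubalgebra.inclusion (S.le_succ n) : S.alg n →⋆ₐ[ℂ] S.alg (n + 1)) :
        S.alg n →ₗ[ℂ] S.alg (n + 1))) where
  pos x := hf.pos (StarSubalgebra.inclusion (S.le_succ n) x)
  normal := hf.normal.comp (S.normal_inclusion n) (fun _ _ h => h) fun _ h => h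
  kms a b := hf.kms (StarSubalgebra.inclusion (S.le_succ n) a)
    (StarSubalgebra.inclusion (S.le_succ n) b)

/-- Superpositions of normal KMS functionals with summable masses. -/
theorem hasSum {ι : Type*} {f : ι → S.alg n →ₗ[ℂ] ℂ} {g : S.alg n →ₗ[ℂ] ℂ}
    (hf : ∀ i, IsKMSFunctional α β (f i)) (h : ∀ x, HasSum (fun i => f i x) (g x)) :
    IsKMSFunctional α β g where
  pos x := (h (star x * x)).nonneg fun i => (hf i).pos x
  normal := IsNormalMap.hasSum (fun i => (hf i).normal) (fun i => (hf i).pos.monotone)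
    (fun i _ hx => (hf i).pos.map_nonneg hx) h
  kms a b := by
    have hs : Summable fun i => (f i 1).re := (Complex.hasSum_re (h 1)).summable
    -- Weierstrass test, with the summable masses f_i(1) times the bound C as majorants.
    have hunif : ∀ (y : ℝ → S.alg n) (C : ℝ), (∀ t, ‖y t‖ ≤ C) →
        TendstoUniformly (fun (s : Finset ι) t => ∑ i ∈ s, f i (y t)) (fun t => g (y t))
          Filter.atTop := by
      intro y C hC
      have := tendstoUniformly_tsum (f := fun i t => f i (y t)) (hs.mul_right C) fun i t =>
        ((hf i).pos.norm_le (y t)).trans (mul_le_mul_of_nonneg_left (hC t)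
          (Complex.nonneg_iff.1 (by simpa using (hf i).pos 1)).1)
      simpa only [fun t => (h (y t)).tsum_eq] using this
    have hC : ∀ t, ‖α.level n t a‖ ≤ ‖a‖ := fun t => (α.norm_at' t a).le
    refine HasStripExtension.of_tendstoUniformly
      (fun s => HasStripExtension.sum s fun i _ => (hf i).kms a b)
      (hunif _ (‖b‖ * ‖a‖) fun t => ?_) (hunif _ (‖a‖ * ‖b‖) fun t => ?_)
    · exact (norm_mul_le _ _).trans (mul_le_mul_of_nonneg_left (hC t) (norm_nonneg _))
    · exact (norm_mul_le _ _).trans (mul_le_mul_of_nonneg_right (hC t) (norm_nonneg _))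

end IsKMSFunctional

end

section


/-! ### Sums of nonnegative complex numbers -/

theorem ofReal_re_of_nonneg {c : ℂ} (h : 0 ≤ c) : (c.re : ℂ) = c :=
  Complex.ext rfl (Complex.nonneg_iff.1 h).2

theorem norm_of_nonneg {c : ℂ} (h : 0 ≤ c) : ‖c‖ = c.re := by
  conv_lhs => rw [← ofReal_re_of_nonneg h]
  exact Complex.norm_of_nonneg (Complex.nonneg_iff.1 h).1

/-- Interchange of the order of summation of nonnegative numbers. -/
theorem hasSum_swap_of_nonneg {ι κ : Type*} {f : ι → κ → ℂ} (h0 : ∀ i k, 0 ≤ f i k) {r : ι → ℂ}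
    {c : κ → ℂ} {s : ℂ} (hr : ∀ i, HasSum (f i) (r i)) (hs : HasSum r s)
    (hc : ∀ k, HasSum (fun i => f i k) (c k)) : HasSum c s := by
  have hre : Summable fun p : ι × κ => (f p.1 p.2).re := by
    refine (summable_prod_of_nonneg fun p => (Complex.nonneg_iff.1 (h0 p.1 p.2)).1).2
      ⟨fun i => (Complex.hasSum_re (hr i)).summable, ?_⟩
    simp only [fun i => (Complex.hasSum_re (hr i)).tsum_eq]
    exact (Complex.hasSum_re hs).summable
  have hsum : Summable fun p : ι × κ => f p.1 p.2 :=
    (Complex.ofRealCLM.summable hre).congr fun p => (ofReal_re_of_nonneg (h0 p.1 p.2))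
  have h1 := hsum.hasSum.prod_fiberwise hr
  have h2 : HasSum (fun p : κ × ι => f p.2 p.1) s := by
    have := (Equiv.prodComm κ ι).hasSum_iff.2 hsum.hasSum
    rwa [h1.unique hs] at this
  exact h2.prod_fiberwise hc

/-- Scheffé's lemma: a family of discrete probability measures that depends pointwise continuously
on a parameter depends continuously on it when tested against a bounded function. -/
theorem continuous_of_hasSum_mul {X ι : Type*} [TopologicalSpace X] {ν : X → ι → ℂ} {c : ι → ℂ}
    {F : X → ℂ} {C : ℝ} (hν : ∀ i, Continuous fun x => ν x i) (h0 : ∀ x i, 0 ≤ ν x i)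
    (h1 : ∀ x, HasSum (ν x) 1) (hc : ∀ i, ‖c i‖ ≤ C)
    (hF : ∀ x, HasSum (fun i => ν x i * c i) (F x)) : Continuous F := by
  refine continuous_of_locally_uniform_approx_of_continuousAt fun x u hu => ?_
  obtain ⟨ε, hε, hεu⟩ := Metric.mem_uniformity_dist.1 hu
  have hre : ∀ x, HasSum (fun i => (ν x i).re) 1 := fun x => by
    simpa using Complex.hasSum_re (h1 x)
  have hC : 0 < |C| + 1 := by positivity
  -- A finite set that carries almost all the mass at x still does so near x, since its mass is
  -- continuous; total mass 1 then bounds the tail at all nearby points. The constant |C| + 1 only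
  -- ensures positivity.
  obtain ⟨s, hs⟩ := ((hre x).eventually (lt_mem_nhds (sub_lt_self 1 (div_pos hε hC)))).exists
  have hcont : Continuous fun y => ∑ i ∈ s, (ν y i).re :=
    continuous_finsetSum _ fun i _ => Complex.continuous_re.comp (hν i)
  refine ⟨_, hcont.continuousAt.eventually (lt_mem_nhds hs), fun y => ∑ i ∈ s, ν y i * c i,
    (continuous_finsetSum _ fun i _ => (hν i).mul continuous_const).continuousAt, fun y hy => ?_⟩
  refine hεu ?_
  rw [dist_eq_norm]
  have e1 : HasSum (fun i : {i // i ∉ s} => ν y i * c i) (F y - ∑ i ∈ s, ν y i * c i) :=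
    (s.hasSum_compl_iff (f := fun i => ν y i * c i)).2 (by simpa using hF y)
  have e2 : HasSum (fun i : {i // i ∉ s} => (ν y i).re) (1 - ∑ i ∈ s, (ν y i).re) :=
    (s.hasSum_compl_iff (f := fun i => (ν y i).re)).2 (by simpa using hre y)
  have e3 : ‖F y - ∑ i ∈ s, ν y i * c i‖ ≤ (1 - ∑ i ∈ s, (ν y i).re) * (|C| + 1) :=
    e1.norm_le_of_bounded (e2.mul_right (|C| + 1)) fun i => by
      rw [norm_mul, norm_of_nonneg (h0 y i)]
      exact mul_le_mul_of_nonneg_left (((hc i).trans (le_abs_self C)).trans (by linarith))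
        (Complex.nonneg_iff.1 (h0 y i)).1
  have hy' : 1 - ε / (|C| + 1) < ∑ i ∈ s, (ν y i).re := hy
  refine e3.trans_lt ?_
  rw [← lt_div_iff₀ hC]
  linarith

theorem tendstoUniformly_of_norm_le {X ι : Type*} {l : Filter ι} {F : ι → X → ℂ} {G : X → ℂ}
    {e : ι → ℝ} (h : ∀ i x, ‖F i x - G x‖ ≤ e i) (he : Filter.Tendsto e l (𝓝 0)) :
    TendstoUniformly F G l := by
  rw [Metric.tendstoUniformly_iff]
  intro ε hε
  filter_upwards [he.eventually (gt_mem_nhds hε)] with i hi x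
  rw [dist_comm, dist_eq_norm]
  exact (h i x).trans_lt hi

variable {A : Type*} [CStarAlgebra A] [PartialOrder A] [StarOrderedRing A]
  {S : AtomicSystem A} {α : InductiveFlow S} {β : ℝ}

/-! ### Restriction of locally normal KMS states -/

/-- The inclusion of a level of the system into the next one. -/
def levelIncl (S : AtomicSystem A) (n : ℕ) : S.alg n →ₗ[ℂ] S.alg (n + 1) :=
  (StarSubalgebra.inclusion (S.le_succ n) : S.alg n →⋆ₐ[ℂ] S.alg (n + 1))

theorem link_eq {n : ℕ} (z : Vertex S (n + 1)) (z' : Vertex S n) :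
    link α β n.lt_succ_self z z' = gibbsFunctional α β z (levelIncl S n (vertexElem z')) := rfl

variable (S) in
/-- The restriction of a functional on `A` to `A_n`. -/
def restrict (ω : WeakDual ℂ A) (n : ℕ) : S.alg n →ₗ[ℂ] ℂ where
  toFun a := ω a
  map_add' a b := map_add ω (a : A) b
  map_smul' c a := map_smul ω c (a : A)

theorem isKMSFunctional_restrict {ω : WeakDual ℂ A} (hω : ω ∈ locallyNormalKMS α β) (n : ℕ) :
    IsKMSFunctional α β (restrict S ω n) where
  pos x := hω.1.1 (x : A)
  normal := hω.2.2 n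
  kms a b := hω.2.1 (a : A) b

theorem norm_apply_le {ω : WeakDual ℂ A} (hω : ω ∈ locallyNormalKMS α β) (a : A) :
    ‖ω a‖ ≤ ‖a‖ := by
  have h : IsPositiveFunctional (WeakDual.toStrongDual ω : A →ₗ[ℂ] ℂ) := hω.1.1
  have h1 := h.norm_le a
  have h2 : (WeakDual.toStrongDual ω : A →ₗ[ℂ] ℂ) 1 = 1 := hω.1.2
  rw [h2, Complex.one_re, one_mul] at h1
  exact h1

theorem exists_alg_of_mem_iUnion {a b : A} (ha : a ∈ ⋃ n, (S.alg n : Set A))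
    (hb : b ∈ ⋃ n, (S.alg n : Set A)) : ∃ n, a ∈ S.alg n ∧ b ∈ S.alg n := by
  obtain ⟨n, hn⟩ := Set.mem_iUnion.1 ha
  obtain ⟨m, hm⟩ := Set.mem_iUnion.1 hb
  have hmono := monotone_nat_of_le_succ S.le_succ
  exact ⟨max n m, hmono (le_max_left _ _) hn, hmono (le_max_right _ _) hm⟩

/-- The expansion of ω on level n + 1, evaluated at a vertex of level n, is literally the harmonic
equation. -/
theorem isHarmonic_of_mem_locallyNormalKMS {ω : WeakDual ℂ A} (hω : ω ∈ locallyNormalKMS α β) :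
    IsHarmonic α β fun z : GradedVertex S => ω (z.2 : A) := fun n z' =>
  (isKMSFunctional_restrict hω (n + 1)).hasSum_gibbsFunctional (levelIncl S n (vertexElem z'))

theorem mem_normalizedPositiveHarmonic [Nontrivial A] {ω : WeakDual ℂ A}
    (hω : ω ∈ locallyNormalKMS α β) :
    (fun z : GradedVertex S => ω (z.2 : A)) ∈ normalizedPositiveHarmonic α β :=
  ⟨isHarmonic_of_mem_locallyNormalKMS hω, fun z => (isKMSFunctional_restrict hω
    z.1).pos.map_projection_nonneg (vertexElem_isStarProjection z.2), hω.1.2⟩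

/-- The vertex values are the coefficients of the expansion on each level, and the union of the
levels is dense. -/
theorem eq_of_eq_on_vertices {ω ω' : WeakDual ℂ A} (hω : ω ∈ locallyNormalKMS α β)
    (hω' : ω' ∈ locallyNormalKMS α β) (h : ∀ z : GradedVertex S, ω (z.2 : A) = ω' (z.2 : A)) :
    ω = ω' := by
  refine DFunLike.coe_injective (Continuous.ext_on S.dense_iUnion (map_continuous ω)
    (map_continuous ω') fun a ha => ?_)
  obtain ⟨n, hn⟩ := Set.mem_iUnion.1 ha
  have h1 := (isKMSFunctional_restrict hω n).hasSum_gibbsFunctional ⟨a, hn⟩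
  have h2 := (isKMSFunctional_restrict hω' n).hasSum_gibbsFunctional ⟨a, hn⟩
  have e : (fun z : Vertex S n => restrict S ω n (vertexElem z) *
      gibbsFunctional α β z ⟨a, hn⟩) = fun z => restrict S ω' n (vertexElem z) *
      gibbsFunctional α β z ⟨a, hn⟩ := funext fun z => congrArg (· * _) (h ⟨n, z⟩)
  rw [e] at h1
  exact h1.unique h2

theorem convex_locallyNormalKMS : Convex ℝ (locallyNormalKMS α β) := by
  intro ω hω ω' hω' s t hs ht hst
  have hs' : (0 : ℂ) ≤ s := by exact_mod_cast hs
  have ht' : (0 : ℂ) ≤ t := by exact_mod_cast ht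
  have happ : ∀ a, (s • ω + t • ω') a = s * ω a + t * ω' a := fun a => rfl
  have hst' : (s : ℂ) + t = 1 := by exact_mod_cast hst
  refine ⟨⟨fun x => ?_, ?_⟩, fun a b => ?_, fun n => ?_⟩
  · rw [happ]
    exact add_nonneg (mul_nonneg hs' (hω.1.1 x)) (mul_nonneg ht' (hω'.1.1 x))
  · rw [happ, hω.1.2, hω'.1.2, mul_one, mul_one, hst']
  · simp only [happ]
    have h1 : HasStripExtension β _ _ := hω.2.1 a b
    have h2 : HasStripExtension β _ _ := hω'.2.1 a b
    exact (h1.const_mul s).add (h2.const_mul t)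
  · have h1 := (isKMSFunctional_restrict hω n).const_mul hs'
    have h2 := (isKMSFunctional_restrict hω' n).const_mul ht'
    exact h1.normal.add h2.normal h1.pos.monotone h2.pos.monotone

/-! ### Harmonic functions and superpositions of local Gibbs states -/

section Harmonic

variable [Nontrivial A]

theorem convex_normalizedPositiveHarmonic : Convex ℝ (normalizedPositiveHarmonic α β) := by
  intro ν hν ν' hν' s t hs ht hst
  have hs' : (0 : ℂ) ≤ s := by exact_mod_cast hs
  have ht' : (0 : ℂ) ≤ t := by exact_mod_cast ht
  have happ : ∀ z, (s • ν + t • ν') z = s * ν z + t * ν' z := fun z => rfl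
  have hst' : (s : ℂ) + t = 1 := by exact_mod_cast hst
  refine ⟨fun n z' => ?_, fun z => ?_, ?_⟩
  · simp only [happ, add_mul, mul_assoc]
    exact ((hν.1 n z').mul_left _).add ((hν'.1 n z').mul_left _)
  · rw [happ]
    exact add_nonneg (mul_nonneg hs' (hν.2.1 z)) (mul_nonneg ht' (hν'.2.1 z))
  · rw [happ, hν.2.2, hν'.2.2, mul_one, mul_one, hst']

variable {ν : GradedVertex S → ℂ}

/-- A harmonic function vanishes at the vertices without local Gibbs state. -/
theorem harmonic_mul_gibbsFunctional_one (hν : IsHarmonic α β ν) (n : ℕ) (z' : Vertex S n) :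
    ν ⟨n, z'⟩ * gibbsFunctional α β z' 1 = ν ⟨n, z'⟩ := by
  refine ((hν n z').mul_right _).unique ?_
  -- The Gibbs state at z restricts to a normal KMS functional on `A_n`, so the link to z' vanishes
  -- unless z' has a Gibbs state.
  have e : ∀ z, ν ⟨n + 1, z⟩ * link α β n.lt_succ_self z z' * gibbsFunctional α β z' 1 =
      ν ⟨n + 1, z⟩ * link α β n.lt_succ_self z z' := fun z => by
    rw [mul_assoc, link_eq]
    congr 1
    exact (isKMSFunctional_gibbsFunctional
      z).comp_inclusion.map_vertexElem_mul_gibbsFunctional_one z'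
  simpa only [e] using hν n z'

theorem eq_one_of_mem_minimalCentralProjections {B : StarSubalgebra ℂ A} (hB : B = ⊥) {z : A}
    (hz : z ∈ minimalCentralProjections B) : z = 1 := by
  subst hB
  obtain ⟨c, rfl⟩ := StarSubalgebra.mem_bot.1 hz.1.1
  have h := hz.1.2.2.isIdempotentElem.eq
  rw [← map_mul] at h
  rcases IsIdempotentElem.iff_eq_zero_or_one.mp ((algebraMap ℂ A).injective h) with h0 | h0
  · exact absurd (by rw [h0, map_zero]) hz.2.1
  · rw [h0, map_one]

/-- A normalized positive harmonic function is a probability measure on each level. -/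
theorem hasSum_level (hν : ν ∈ normalizedPositiveHarmonic α β) (n : ℕ) :
    HasSum (fun z : Vertex S n => ν ⟨n, z⟩) 1 := by
  induction n with
  | zero =>
    have h : ∀ z : Vertex S 0, (⟨0, z⟩ : GradedVertex S) = root S := fun z => by
      have : z = (root S).2 :=
        Subtype.ext (eq_one_of_mem_minimalCentralProjections S.alg_zero z.2)
      rw [this]
      rfl
    have := hasSum_single (f := fun z : Vertex S 0 => ν ⟨0, z⟩) (root S).2 fun z hz =>
      absurd (eq_of_heq (Sigma.mk.inj (h z)).2) hz
    rwa [show ν ⟨0, (root S).2⟩ = 1 from hν.2.2] at this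
  | succ n ih =>
    -- Sum the harmonic equations over z' and interchange: the links from z add up to τ_z(1), which
    -- is 1 wherever ν(z) ≠ 0.
    refine hasSum_swap_of_nonneg
      (f := fun (z' : Vertex S n) z => ν ⟨n + 1, z⟩ * link α β n.lt_succ_self z z')
      (fun z' z => mul_nonneg (hν.2.1 _) ?_) (hν.1 n) ih fun z => ?_
    · exact (isKMSFunctional_gibbsFunctional z).comp_inclusion.pos.map_projection_nonneg
        (vertexElem_isStarProjection z')
    · have h1 := (isKMSFunctional_gibbsFunctional (α := α) (β := β)
        z).comp_inclusion.hasSum_gibbsFunctional 1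
      simp only [(isKMSFunctional_gibbsFunctional (α := α) (β := β)
        z).comp_inclusion.map_vertexElem_mul_gibbsFunctional_one] at h1
      have h2 := h1.mul_left (ν ⟨n + 1, z⟩)
      have h3 : levelIncl S n 1 = 1 := rfl
      change HasSum _ (ν ⟨n + 1, z⟩ * gibbsFunctional α β z (levelIncl S n 1)) at h2
      rw [h3, harmonic_mul_gibbsFunctional_one hν.1] at h2
      exact h2

theorem summable_superposition (hν : ν ∈ normalizedPositiveHarmonic α β) {n : ℕ} (x : S.alg n) :
    Summable fun z : Vertex S n => ν ⟨n, z⟩ * gibbsFunctional α β z x := by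
  refine Summable.of_norm_bounded
    (((Complex.hasSum_re (hasSum_level hν n)).summable).mul_right ‖x‖) fun z => ?_
  rw [norm_mul, norm_of_nonneg (hν.2.1 _)]
  exact mul_le_mul_of_nonneg_left (norm_gibbsFunctional_le z x) (Complex.nonneg_iff.1 (hν.2.1 _)).1

/-- The superposition of the local Gibbs states on `A_n` with the weights given by a harmonic
function. -/
def superposition (hν : ν ∈ normalizedPositiveHarmonic α β) (n : ℕ) : S.alg n →ₗ[ℂ] ℂ where
  toFun x := ∑' z : Vertex S n, ν ⟨n, z⟩ * gibbsFunctional α β z x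
  map_add' x y := by
    simp only [map_add, mul_add]
    exact (summable_superposition hν x).tsum_add (summable_superposition hν y)
  map_smul' c x := by
    simp only [map_smul, smul_eq_mul, RingHom.id_apply, mul_left_comm _ c]
    exact tsum_mul_left

theorem hasSum_superposition (hν : ν ∈ normalizedPositiveHarmonic α β) {n : ℕ} (x : S.alg n) :
    HasSum (fun z : Vertex S n => ν ⟨n, z⟩ * gibbsFunctional α β z x) (superposition hν n x) :=
  (summable_superposition hν x).hasSum

theorem isKMSFunctional_superposition (hν : ν ∈ normalizedPositiveHarmonic α β) (n : ℕ) :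
    IsKMSFunctional α β (superposition hν n) :=
  IsKMSFunctional.hasSum (f := fun z : Vertex S n => ν ⟨n, z⟩ • gibbsFunctional α β z)
    (fun z => (isKMSFunctional_gibbsFunctional z).const_mul (hν.2.1 _)) (hasSum_superposition hν)

theorem superposition_one (hν : ν ∈ normalizedPositiveHarmonic α β) (n : ℕ) :
    superposition hν n 1 = 1 := by
  have := hasSum_superposition hν (1 : S.alg n)
  simp only [harmonic_mul_gibbsFunctional_one hν.1] at this
  exact this.unique (hasSum_level hν n)

theorem superposition_levelIncl_vertexElem (hν : ν ∈ normalizedPositiveHarmonic α β) (n : ℕ)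
    (z' : Vertex S n) : superposition hν (n + 1) (levelIncl S n (vertexElem z')) = ν ⟨n, z'⟩ :=
  (hasSum_superposition hν _).unique (hν.1 n z')

/-- Harmonicity alone gives equality at the vertices. As both sides are normal KMS functionals,
equal masses give equality everywhere. -/
theorem superposition_levelIncl (hν : ν ∈ normalizedPositiveHarmonic α β) (n : ℕ) (x : S.alg n) :
    superposition hν (n + 1) (levelIncl S n x) = superposition hν n x := by
  have h1 := (isKMSFunctional_superposition hν (n + 1)).comp_inclusion.hasSum_gibbsFunctional x
  have e : ∀ z' : Vertex S n, (superposition hν (n + 1) ∘ₗ levelIncl S n) (vertexElem z') =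
    ν ⟨n, z'⟩ := superposition_levelIncl_vertexElem hν n
  change HasSum (fun z' => (superposition hν (n + 1) ∘ₗ levelIncl S n) (vertexElem z') * _) _ at h1
  simp only [e] at h1
  exact h1.unique (hasSum_superposition hν x)

theorem superposition_vertexElem (hν : ν ∈ normalizedPositiveHarmonic α β) (n : ℕ)
    (z : Vertex S n) : superposition hν n (vertexElem z) = ν ⟨n, z⟩ := by
  rw [← superposition_levelIncl, superposition_levelIncl_vertexElem]

end Harmonic

/-! ### Passage to the inductive limit and continuity of the inverse -/

/-- A consistent family of contractive functionals on the levels extends to the inductive limit. -/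
theorem exists_extension_of_consistent (f : ∀ n, S.alg n →ₗ[ℂ] ℂ)
    (hf : ∀ n x, f (n + 1) (levelIncl S n x) = f n x) (hb : ∀ n x, ‖f n x‖ ≤ ‖x‖) :
    ∃ ω : WeakDual ℂ A, ∀ n (x : S.alg n), ω x = f n x := by
  have hmono := monotone_nat_of_le_succ S.le_succ
  have hcons : ∀ m n, m ≤ n → ∀ (x : A) (hm : x ∈ S.alg m) (hn : x ∈ S.alg n),
      f m ⟨x, hm⟩ = f n ⟨x, hn⟩ := by
    intro m n hmn
    induction n, hmn using Nat.le_induction with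
    | base => exact fun _ _ _ => rfl
    | succ n hmn ih => exact fun x hm hn => (ih x hm (hmono hmn hm)).trans (hf n _).symm
  have hcons' : ∀ m n (x : A) (hm : x ∈ S.alg m) (hn : x ∈ S.alg n),
      f m ⟨x, hm⟩ = f n ⟨x, hn⟩ := fun m n x hm hn =>
    (le_total m n).elim (fun h => hcons m n h x hm hn) fun h => (hcons n m h x hn hm).symm
  let U : Submodule ℂ A :=
    { carrier := ⋃ n, (S.alg n : Set A)
      add_mem' := fun ha hb => by
        obtain ⟨n, hna, hnb⟩ := exists_alg_of_mem_iUnion ha hb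
        exact Set.mem_iUnion.2 ⟨n, add_mem hna hnb⟩
      zero_mem' := Set.mem_iUnion.2 ⟨0, zero_mem _⟩
      smul_mem' := fun c a ha => by
        obtain ⟨n, hn⟩ := Set.mem_iUnion.1 ha
        exact Set.mem_iUnion.2 ⟨n, (S.alg n).smul_mem hn c⟩ }
  have hU : ∀ x : U, ∃ n, (x : A) ∈ S.alg n := fun x => Set.mem_iUnion.1 x.2
  choose N hN using hU
  have hg : ∀ (x : U) n (hn : (x : A) ∈ S.alg n), f (N x) ⟨x, hN x⟩ = f n ⟨x, hn⟩ :=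
    fun x n hn => hcons' _ _ _ _ _
  let g : U →ₗ[ℂ] ℂ :=
    { toFun := fun x => f (N x) ⟨x, hN x⟩
      map_add' := fun x y => by
        obtain ⟨n, hx, hy⟩ := exists_alg_of_mem_iUnion x.2 y.2
        rw [hg x n hx, hg y n hy, hg (x + y) n (add_mem hx hy), ← map_add]
        rfl
      map_smul' := fun c x => by
        rw [hg (c • x) (N x) ((S.alg (N x)).smul_mem (hN x) c), RingHom.id_apply, ← map_smul]
        rfl }
  -- Hahn–Banach supplies the extension from the union of the levels.
  obtain ⟨ω, hω, -⟩ := exists_extension_norm_eq U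
    (g.mkContinuous 1 fun x => by rw [one_mul]; exact hb _ _)
  exact ⟨StrongDual.toWeakDual ω, fun n x =>
    (hω ⟨x, Set.mem_iUnion.2 ⟨n, x.2⟩⟩).trans (hg _ n x.2)⟩

/-- A continuous functional whose restrictions to the levels are normal KMS states is a locally
normal KMS state. -/
theorem mem_locallyNormalKMS {ω : WeakDual ℂ A}
    (h : ∀ n, IsKMSFunctional α β (restrict S ω n)) (hone : ω 1 = 1) :
    ω ∈ locallyNormalKMS α β := by
  refine ⟨⟨fun a => ?_, hone⟩, fun a b => ?_, fun n => (h n).normal⟩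
  · have hcl : IsClosed {a : A | 0 ≤ ω (star a * a)} :=
      isClosed_Ici.preimage ((map_continuous ω).comp (continuous_star.mul continuous_id))
    exact S.dense_iUnion.induction (P := fun a => 0 ≤ ω (star a * a)) (fun a ha => by
      obtain ⟨n, hn⟩ := Set.mem_iUnion.1 ha
      exact (h n).pos ⟨a, hn⟩) hcl a
  -- Approximate a and b from the levels. As α_t is isometric, the boundary values converge
  -- uniformly in t, with no continuity of t ↦ α_t(a) needed.
  · obtain ⟨u, hu, hua⟩ := mem_closure_iff_seq_limit.1 (S.dense_iUnion a)
    obtain ⟨v, hv, hvb⟩ := mem_closure_iff_seq_limit.1 (S.dense_iUnion b)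
    have hstrip : ∀ k, HasStripExtension β (fun t => ω (v k * α.at' t (u k)))
        (fun t => ω (α.at' t (u k) * v k)) := fun k => by
      obtain ⟨n, h1, h2⟩ := exists_alg_of_mem_iUnion (hu k) (hv k)
      exact (h n).kms ⟨u k, h1⟩ ⟨v k, h2⟩
    have hω : ∀ x, ‖ω x‖ ≤ ‖WeakDual.toStrongDual ω‖ * ‖x‖ := fun x =>
      (WeakDual.toStrongDual ω).le_opNorm x
    have ha0 := tendsto_iff_norm_sub_tendsto_zero.1 hua
    have hb0 := tendsto_iff_norm_sub_tendsto_zero.1 hvb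
    have hsub : ∀ t k, ‖α.at' t (u k) - α.at' t a‖ = ‖u k - a‖ := fun t k => by
      rw [← α.norm_at' t (u k - a)]
      exact congrArg _ (map_sub (α.aut (Multiplicative.ofAdd t)) _ _).symm
    have he : Filter.Tendsto (fun k => ‖WeakDual.toStrongDual ω‖ *
        (‖v k - b‖ * ‖u k‖ + ‖b‖ * ‖u k - a‖)) Filter.atTop (𝓝 0) := by
      have := ((hb0.mul hua.norm).add (ha0.const_mul ‖b‖)).const_mul ‖WeakDual.toStrongDual ω‖
      simpa using this
    refine HasStripExtension.of_tendstoUniformly hstrip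
      (tendstoUniformly_of_norm_le (fun k t => ?_) he)
      (tendstoUniformly_of_norm_le (fun k t => ?_) he)
    · rw [← map_sub]
      refine (hω _).trans (mul_le_mul_of_nonneg_left ?_ (norm_nonneg _))
      have e : v k * α.at' t (u k) - b * α.at' t a =
          (v k - b) * α.at' t (u k) + b * (α.at' t (u k) - α.at' t a) := by noncomm_ring
      rw [e]
      refine (norm_add_le _ _).trans (add_le_add ((norm_mul_le _ _).trans ?_)
        ((norm_mul_le _ _).trans ?_))
      · rw [α.norm_at']
      · rw [hsub]
    · rw [← map_sub]
      refine (hω _).trans (mul_le_mul_of_nonneg_left ?_ (norm_nonneg _))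
      have e : α.at' t (u k) * v k - α.at' t a * b =
          α.at' t (u k) * (v k - b) + (α.at' t (u k) - α.at' t a) * b := by noncomm_ring
      rw [e]
      refine (norm_add_le _ _).trans (add_le_add ((norm_mul_le _ _).trans ?_)
        ((norm_mul_le _ _).trans ?_))
      · rw [α.norm_at', mul_comm]
      · rw [hsub, mul_comm]

/-- Every normalized positive harmonic function comes from a locally normal KMS state. -/
theorem exists_locallyNormalKMS [Nontrivial A] {ν : GradedVertex S → ℂ}
    (hν : ν ∈ normalizedPositiveHarmonic α β) :
    ∃ ω ∈ locallyNormalKMS α β, ∀ z : GradedVertex S, ω (z.2 : A) = ν z := by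
  obtain ⟨ω, hω⟩ := exists_extension_of_consistent (superposition hν)
    (superposition_levelIncl hν) fun n x => by
      have := (isKMSFunctional_superposition hν n).pos.norm_le x
      rwa [superposition_one, Complex.one_re, one_mul] at this
  have hr : ∀ n, restrict S ω n = superposition hν n := fun n => LinearMap.ext fun x => hω n x
  refine ⟨ω, mem_locallyNormalKMS (fun n => hr n ▸ isKMSFunctional_superposition hν n) ?_,
    fun z => ?_⟩
  · exact (hω 0 1).trans (superposition_one hν 0)
  · exact (hω z.1 (vertexElem z.2)).trans (superposition_vertexElem hν z.1 z.2)

/-- The evaluation of a locally normal KMS state depends continuously on its values on the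
vertices. -/
theorem continuous_eval_of_harmonic [Nontrivial A]
    {Ψ : normalizedPositiveHarmonic α β → locallyNormalKMS α β}
    (hΨ : ∀ ν z, (Ψ ν : WeakDual ℂ A) (z.2 : A) = (ν : GradedVertex S → ℂ) z) (a : A) :
    Continuous fun ν => (Ψ ν : WeakDual ℂ A) a := by
  have hlevel : ∀ n (x : S.alg n), Continuous fun ν => (Ψ ν : WeakDual ℂ A) (x : A) := fun n x => by
    refine continuous_of_hasSum_mul
      (ν := fun (ν : normalizedPositiveHarmonic α β) (z : Vertex S n) => ν.1 ⟨n, z⟩)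
      (c := fun z => gibbsFunctional α β z x) (fun z => (continuous_apply _).comp
        continuous_subtype_val) (fun ν z => ν.2.2.1 _) (fun ν => hasSum_level ν.2 n)
      (fun z => norm_gibbsFunctional_le z x) fun ν => ?_
    have := (isKMSFunctional_restrict (Ψ ν).2 n).hasSum_gibbsFunctional x
    have e : ∀ z : Vertex S n, restrict S (Ψ ν) n (vertexElem z) = ν.1 ⟨n, z⟩ := fun z =>
      hΨ ν ⟨n, z⟩
    simp only [e] at this
    exact this
  -- States are contractive, so evaluation at a is a uniform limit of evaluations at elements of the
  -- levels.
  refine continuous_of_uniform_approx_of_continuous fun u hu => ?_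
  obtain ⟨ε, hε, hεu⟩ := Metric.mem_uniformity_dist.1 hu
  obtain ⟨a', ha', hdist⟩ := Metric.dense_iff.1 S.dense_iUnion a ε hε |>.imp fun _ h => h.symm
  obtain ⟨n, hn⟩ := Set.mem_iUnion.1 ha'
  refine ⟨_, hlevel n ⟨a', hn⟩, fun ν => hεu ?_⟩
  rw [dist_eq_norm, ← map_sub]
  refine (norm_apply_le (Ψ ν).2 _).trans_lt ?_
  rwa [← dist_eq_norm, dist_comm]

end

end InductiveKMS

end

/-! ### The affine homeomorphism -/

open InductiveKMS in
theorem proposition7p10 {A : Type*} [CStarAlgebra A] [PartialOrder A] [StarOrderedRing A]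
    [Nontrivial A] (S : AtomicSystem A) (α : InductiveFlow S) (β : ℝ) :
    Convex ℝ (locallyNormalKMS α β) ∧ Convex ℝ (normalizedPositiveHarmonic α β) ∧
    ∃ Φ : locallyNormalKMS α β ≃ₜ normalizedPositiveHarmonic α β,
      (∀ (ω : locallyNormalKMS α β) (z : GradedVertex S),
        (Φ ω : GradedVertex S → ℂ) z = (ω : WeakDual ℂ A) (z.2 : A)) ∧
      (∀ ω : locallyNormalKMS α β, ∃ C : ℝ, ∀ z : GradedVertex S,
        ‖(Φ ω : GradedVertex S → ℂ) z‖ ≤ C) ∧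
      (∀ (ω₁ ω₂ ω : locallyNormalKMS α β) (s t : ℝ), 0 ≤ s → 0 ≤ t → s + t = 1 →
        (ω : WeakDual ℂ A) = s • (ω₁ : WeakDual ℂ A) + t • (ω₂ : WeakDual ℂ A) →
        (Φ ω : GradedVertex S → ℂ) =
          s • (Φ ω₁ : GradedVertex S → ℂ) + t • (Φ ω₂ : GradedVertex S → ℂ)) := by
  refine ⟨convex_locallyNormalKMS, convex_normalizedPositiveHarmonic, ?_⟩
  choose Ψ hΨmem hΨ using fun ν : normalizedPositiveHarmonic α β => exists_locallyNormalKMS ν.2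
  refine ⟨⟨⟨fun ω => ⟨fun z => (ω : WeakDual ℂ A) (z.2 : A), mem_normalizedPositiveHarmonic ω.2⟩,
    fun ν => ⟨Ψ ν, hΨmem ν⟩, fun ω => ?_, fun ν => ?_⟩, ?_, ?_⟩, fun ω z => rfl,
    fun ω => ⟨1, fun z => ?_⟩, fun ω₁ ω₂ ω s t _ _ _ h => ?_⟩
  · exact Subtype.ext (eq_of_eq_on_vertices (hΨmem _) ω.2 (hΨ _))
  · exact Subtype.ext (funext (hΨ ν))
  · exact (continuous_pi fun z : GradedVertex S => (WeakDual.eval_continuous (z.2 : A)).comp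
      continuous_subtype_val).subtype_mk _
  · exact (WeakDual.continuous_of_continuous_eval fun a =>
      continuous_eval_of_harmonic (Ψ := fun ν => ⟨Ψ ν, hΨmem ν⟩) hΨ a).subtype_mk _
  · exact (norm_apply_le ω.2 _).trans (IsStarProjection.norm_le _ z.2.2.1.2.2)
  · funext z
    exact DFunLike.congr_fun h (z.2 : A)
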